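/- Let $\Omega\subset\mathbb R^2$ be a bounded domain with Lipschitz boundary and let $k\ge 0$. For $j=1,2$ let $D_j$ be a polygon, i.e. the open set enclosed by a simple closed polygonal curve, with $\overline{D_j}\subset\Omega$; let $\rho_j\in L^2(D_j)$ be such that for each vertex $p$ of $D_j$ there are $\eta>0$, $0<\alpha\le 1$ and a function $\tilde\rho\in C^{0,\alpha}(\overline{B(p,\eta)})$ with $\rho_j=\tilde\rho$ almost everywhere on $B(p,\eta)\cap D_j$ and $\tilde\rho(p)\neq 0$; and let $a_j$ be a nonzero constant vector. All functions are complex valued and $a_j\in\mathbb C^2$ (in particular, real $\rho_j$ and $a_j$ are allowed). Let $F_j=\nabla\cdot(\rho_j\chi_{D_j}a_j)$, i.e. $$F_j(\varphi)=-\int_{D_j}\rho_j\,a_j\cdot\nabla\varphi\,dx ,\qquad \varphi\in H^1_0(\Omega),$$ and let $u_j\in H^1(\Omega)$ be a weak solution of $\Delta u_j+k^2u_j=F_j$ in $\Omega$, i.e. $-\int_\Omega\nabla u_j\cdot\nabla\varphi\,dx+k^2\int_\Omega u_j\varphi\,dx=F_j(\varphi)$ for all $\varphi\in H^1_0(\Omega)$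 (no complex conjugates). Its Cauchy data on $\partial\Omega$ are the trace $u_j|_{\partial\Omega}$ and the Neumann derivative $\frac{\partial u_j}{\partial\nu}\big|_{\partial\Omega}$, the functional on $H^{1/2}(\partial\Omega)$ (the space of traces of $H^1(\Omega)$) given by $$\Big\langle\frac{\partial u_j}{\partial\nu}\Big|_{\partial\Omega},g\Big\rangle=\int_\Omega\nabla u_j\cdot\nabla w\,dx-k^2\int_\Omega u_jw\,dx+F_j(\psi w),$$ where $w\in H^1(\Omega)$ is any function with trace $g$ and $\psi\in C_0^\infty(\Omega)$ is any function equal to $1$ in a neighbourhood of $\operatorname{supp}F_j$. If $$\Big(u_1|_{\partial\Omega},\frac{\partial u_1}{\partial\nu}\Big|_{\partial\Omega}\Big)=\Big(u_2|_{\partial\Omega},\frac{\partial u_2}{\partial\nu}\Big|_{\partial\Omega}\Big),$$ then the convex hulls of $D_1$ and $D_2$ coincide: $[D_1]=[D_2]$. -/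

import Mathlib

open MeasureTheory Filter Topology TopologicalSpace
open scoped Distributions ContDiff ENNReal NNReal

/-- The Euclidean plane. -/
abbrev Plane : Type := EuclideanSpace ℝ (Fin 2)

/-- Classical `i`-th partial derivative of a complex-valued function on the plane. -/
noncomputable def pderiv (i : Fin 2) (f : Plane → ℂ) (x : Plane) : ℂ :=
  fderiv ℝ f x (EuclideanSpace.single i 1)

/-! ### Lipschitz domains -/

/-- A bounded domain (non-empty connected open set) with Lipschitz boundary: near each boundary
point, in suitable orthonormal coordinates, it is the strict subgraph of a Lipschitz function. -/
structure IsLipschitzDomain (Ω : Opens Plane) : Prop where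
  isConnected : IsConnected (Ω : Set Plane)
  isBounded : Bornology.IsBounded (Ω : Set Plane)
  lipschitz_boundary : ∀ p ∈ frontier (Ω : Set Plane),
    ∃ (L : Plane ≃ₗᵢ[ℝ] Plane) (γ : ℝ → ℝ) (K : ℝ≥0), LipschitzWith K γ ∧
      ∀ᶠ x in 𝓝 p, (x ∈ Ω ↔ (L x) 1 < γ ((L x) 0))

/-! ### Polygons -/

/-- The closed polygonal curve `P` is simple with vertices exactly its corners: consecutive vertices
are not collinear (so that adjacent edges meet only in their common vertex), and edges that are
not adjacent are disjoint. -/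
def IsSimplePolygon {n : ℕ} [NeZero n] (P : Polygon Plane n) : Prop :=
  P.HasNondegenerateVertices ℝ ∧
    ∀ i j : Fin n, j ≠ i → j ≠ finRotate n i → i ≠ finRotate n j →
      Disjoint (P.edgeSet ℝ i) (P.edgeSet ℝ j)

/-- The open set `D` is the inside of the simple closed polygonal curve `P`. -/
structure IsPolygonInterior {n : ℕ} [NeZero n] (P : Polygon Plane n) (D : Set Plane) : Prop where
  isSimple : IsSimplePolygon P
  isOpen : IsOpen D
  isConnected : IsConnected D
  isBounded : Bornology.IsBounded D
  frontier_eq : frontier D = P.boundary ℝ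

/-! ### The Sobolev space `H¹(Ω)` -/

/-- An element of the complex Sobolev space `H¹(Ω)`: a function in `L²(Ω)` together with its weak
gradient in `L²(Ω)²` (representatives of the almost-everywhere classes). -/
structure SobolevH1 (Ω : Opens Plane) where
  toFun : Plane → ℂ
  grad : Fin 2 → Plane → ℂ
  memLp : MemLp toFun 2 (volume.restrict Ω)
  grad_memLp : ∀ i, MemLp (grad i) 2 (volume.restrict Ω)
  weak_deriv : ∀ (φ : 𝓓(Ω, ℂ)) (i : Fin 2),
    ∫ x in Ω, toFun x * pderiv i φ x = - ∫ x in Ω, grad i x * φ x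

theorem continuous_pderiv {f : Plane → ℂ} (hf : ContDiff ℝ ∞ f) (i : Fin 2) :
    Continuous (pderiv i f) :=
  (hf.continuous_fderiv (by simp)).clm_apply continuous_const

theorem hasCompactSupport_pderiv {f : Plane → ℂ} (hf : HasCompactSupport f) (i : Fin 2) :
    HasCompactSupport (pderiv i f) :=
  (hf.fderiv ℝ).comp_left (g := fun A : Plane →L[ℝ] ℂ => A (EuclideanSpace.single i 1)) rfl

theorem pderiv_eq_zero_of_notMem {Ω : Opens Plane} (φ : 𝓓(Ω, ℂ)) (i : Fin 2) {x : Plane}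
    (hx : x ∉ Ω) : pderiv i φ x = 0 := by
  have h : x ∉ tsupport (fderiv ℝ φ) := fun h =>
    hx (φ.tsupport_subset (tsupport_fderiv_subset ℝ h))
  simp [pderiv, image_eq_zero_of_notMem_tsupport h]

theorem apply_eq_zero_of_notMem {Ω : Opens Plane} (φ : 𝓓(Ω, ℂ)) {x : Plane}
    (hx : x ∉ Ω) : φ x = 0 :=
  image_eq_zero_of_notMem_tsupport fun h => hx (φ.tsupport_subset h)

/-- A test function as an element of `H¹(Ω)`. -/
noncomputable def SobolevH1.ofTestFunction {Ω : Opens Plane} (χ : 𝓓(Ω, ℂ)) : SobolevH1 Ω where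
  toFun := χ
  grad i := pderiv i χ
  memLp := (χ.continuous.memLp_of_hasCompactSupport χ.hasCompactSupport)
  grad_memLp i := (continuous_pderiv χ.contDiff i).memLp_of_hasCompactSupport
    (hasCompactSupport_pderiv χ.hasCompactSupport i)
  weak_deriv φ i := by
    have h1 := continuous_pderiv χ.contDiff i
    have h2 := continuous_pderiv φ.contDiff i
    rw [setIntegral_eq_integral_of_forall_compl_eq_zero (fun x hx => by
        rw [apply_eq_zero_of_notMem χ hx, zero_mul]),
      setIntegral_eq_integral_of_forall_compl_eq_zero (fun x hx => by
        rw [apply_eq_zero_of_notMem φ hx, mul_zero])]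
    exact integral_mul_fderiv_eq_neg_fderiv_mul_of_integrable
      ((h1.mul φ.continuous).integrable_of_hasCompactSupport φ.hasCompactSupport.mul_left)
      ((χ.continuous.mul h2).integrable_of_hasCompactSupport χ.hasCompactSupport.mul_right)
      ((χ.continuous.mul φ.continuous).integrable_of_hasCompactSupport
        χ.hasCompactSupport.mul_right)
      (fun x _ => χ.contDiff.differentiable (by simp) x)
      (fun x _ => φ.contDiff.differentiable (by simp) x)

/-- The product of two test functions. -/
noncomputable def testMul {Ω : Opens Plane} (ψ φ : 𝓓(Ω, ℂ)) : 𝓓(Ω, ℂ) where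
  toFun x := ψ x * φ x
  contDiff' := ψ.contDiff.mul φ.contDiff
  hasCompactSupport' := ψ.hasCompactSupport.mul_right
  tsupport_subset' := (tsupport_mul_subset_left).trans ψ.tsupport_subset

theorem pderiv_testMul {Ω : Opens Plane} (ψ φ : 𝓓(Ω, ℂ)) (i : Fin 2) (x : Plane) :
    pderiv i (testMul ψ φ) x = ψ x * pderiv i φ x + pderiv i ψ x * φ x := by
  have h : (testMul ψ φ : Plane → ℂ) = fun x => ψ x * φ x := rfl
  rw [pderiv, h, fderiv_fun_mul (ψ.contDiff.differentiable (by simp) x)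
    (φ.contDiff.differentiable (by simp) x)]
  simp [pderiv, mul_comm]

theorem memLp_mul_of_compact {Ω : Opens Plane} {f w : Plane → ℂ} (hf : Continuous f)
    (hc : HasCompactSupport f) (hw : MemLp w 2 (volume.restrict Ω)) :
    MemLp (fun x => f x * w x) 2 (volume.restrict Ω) :=
  MemLp.mul (p := ∞) (q := 2) hw (hf.memLp_top_of_hasCompactSupport hc _)

/-- The product `ψ w` of a test function `ψ` and `w ∈ H¹(Ω)`, with gradient
`ψ ∇w + w ∇ψ`. -/
noncomputable def SobolevH1.cutoff {Ω : Opens Plane} (ψ : 𝓓(Ω, ℂ)) (w : SobolevH1 Ω) :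
    SobolevH1 Ω where
  toFun x := ψ x * w.toFun x
  grad i x := ψ x * w.grad i x + pderiv i ψ x * w.toFun x
  memLp := memLp_mul_of_compact ψ.continuous ψ.hasCompactSupport w.memLp
  grad_memLp i := (memLp_mul_of_compact ψ.continuous ψ.hasCompactSupport (w.grad_memLp i)).add
    (memLp_mul_of_compact (continuous_pderiv ψ.contDiff i)
      (hasCompactSupport_pderiv ψ.hasCompactSupport i) w.memLp)
  weak_deriv φ i := by
    have hφ : MemLp φ 2 (volume.restrict (Ω : Set Plane)) :=
      φ.continuous.memLp_of_hasCompactSupport φ.hasCompactSupport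
    have hφ' : MemLp (pderiv i φ) 2 (volume.restrict (Ω : Set Plane)) :=
      (continuous_pderiv φ.contDiff i).memLp_of_hasCompactSupport
        (hasCompactSupport_pderiv φ.hasCompactSupport i)
    have hA : Integrable (fun x => ψ x * w.toFun x * pderiv i φ x) (volume.restrict Ω) :=
      (memLp_mul_of_compact ψ.continuous ψ.hasCompactSupport w.memLp).integrable_mul hφ'
    have hB : Integrable (fun x => pderiv i ψ x * w.toFun x * φ x) (volume.restrict Ω) :=
      (memLp_mul_of_compact (continuous_pderiv ψ.contDiff i)
      (hasCompactSupport_pderiv ψ.hasCompactSupport i) w.memLp).integrable_mul hφ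
    have hC : Integrable (fun x => ψ x * w.grad i x * φ x) (volume.restrict Ω) :=
      (memLp_mul_of_compact ψ.continuous ψ.hasCompactSupport
      (w.grad_memLp i)).integrable_mul hφ
    have key := w.weak_deriv (testMul ψ φ) i
    have e1 : ∫ x in Ω, w.toFun x * pderiv i (testMul ψ φ) x
        = (∫ x in Ω, ψ x * w.toFun x * pderiv i φ x)
          + ∫ x in Ω, pderiv i ψ x * w.toFun x * φ x := by
      rw [← integral_add hA hB]
      refine integral_congr_ae (Eventually.of_forall fun x => ?_)
      simp only [pderiv_testMul]
      ring
    have e2 : ∫ x in Ω, w.grad i x * (testMul ψ φ) x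
        = ∫ x in Ω, ψ x * w.grad i x * φ x := by
      refine integral_congr_ae (Eventually.of_forall fun x => ?_)
      change w.grad i x * (ψ x * φ x) = _
      ring
    have e3 : ∫ x in Ω, (ψ x * w.grad i x + pderiv i ψ x * w.toFun x) * φ x
        = (∫ x in Ω, ψ x * w.grad i x * φ x)
          + ∫ x in Ω, pderiv i ψ x * w.toFun x * φ x := by
      rw [← integral_add hC hB]
      refine integral_congr_ae (Eventually.of_forall fun x => ?_)
      ring
    rw [e1, e2] at key
    rw [e3, neg_add, ← key]
    ring

/-- Convergence in `H¹(Ω)` of a sequence of (classically differentiable) functions to `u`. -/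
def TendstoH1 {Ω : Opens Plane} (f : ℕ → Plane → ℂ) (u : SobolevH1 Ω) : Prop :=
  Tendsto (fun m => eLpNorm (fun x => f m x - u.toFun x) 2 (volume.restrict Ω)) atTop (𝓝 0) ∧
    ∀ i, Tendsto (fun m => eLpNorm (fun x => pderiv i (f m) x - u.grad i x) 2
      (volume.restrict Ω)) atTop (𝓝 0)

/-- Membership in `H¹₀(Ω)`, the closure of the test functions in `H¹(Ω)`. -/
def SobolevH1.MemH10 {Ω : Opens Plane} (u : SobolevH1 Ω) : Prop :=
  ∃ χ : ℕ → 𝓓(Ω, ℂ), TendstoH1 (fun m => χ m) u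

/-! ### Traces and Cauchy data on the boundary -/

/-- Arc length on `∂Ω` (one-dimensional Hausdorff measure). -/
noncomputable def boundaryMeasure (Ω : Opens Plane) : Measure Plane :=
  (Measure.hausdorffMeasure 1).restrict (frontier (Ω : Set Plane))

/-- `L²(∂Ω)`. -/
abbrev BoundaryL2 (Ω : Opens Plane) : Type := Lp ℂ 2 (boundaryMeasure Ω)

/-- `g` is the trace `u|_∂Ω`: there are functions smooth up to the boundary that converge to `u` in
`H¹(Ω)` and whose boundary values converge to `g` in `L²(∂Ω)`. -/
def HasTrace {Ω : Opens Plane} (u : SobolevH1 Ω) (g : BoundaryL2 Ω) : Prop :=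
  ∃ f : ℕ → Plane → ℂ, (∀ m, ContDiff ℝ ∞ (f m)) ∧ TendstoH1 f u ∧
    Tendsto (fun m => eLpNorm (fun x => f m x - g x) 2 (boundaryMeasure Ω)) atTop (𝓝 0)

/-- `H^{1/2}(∂Ω)`, the set of traces of elements of `H¹(Ω)`. -/
def TraceSpace (Ω : Opens Plane) : Set (BoundaryL2 Ω) := {g | ∃ w : SobolevH1 Ω, HasTrace w g}

/-- The bilinear form `∫_Ω ∇u·∇w - k² ∫_Ω u w`. -/
noncomputable def helmholtzForm {Ω : Opens Plane} (k : ℝ) (u w : SobolevH1 Ω) : ℂ :=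
  (∫ x in Ω, ∑ i, u.grad i x * w.grad i x) - (k : ℂ) ^ 2 * ∫ x in Ω, u.toFun x * w.toFun x

/-- `u` is a weak solution of `Δu + k² u = F` in `Ω`. -/
def IsWeakSolution {Ω : Opens Plane} (k : ℝ) (F : SobolevH1 Ω → ℂ) (u : SobolevH1 Ω) : Prop :=
  ∀ φ : SobolevH1 Ω, φ.MemH10 → - helmholtzForm k u φ = F φ

/-- The support of the distribution `F` on `Ω`. -/
def sourceSupport {Ω : Opens Plane} (F : SobolevH1 Ω → ℂ) : Set Plane :=
  {x | x ∈ Ω ∧ ∀ U ∈ 𝓝 x, ∃ χ : 𝓓(Ω, ℂ), tsupport χ ⊆ U ∧ F (SobolevH1.ofTestFunction χ) ≠ 0}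

/-- `ψ` is a test function on `Ω` equal to `1` in a neighbourhood of the support of `F`. -/
def IsCutoffFor {Ω : Opens Plane} (F : SobolevH1 Ω → ℂ) (ψ : 𝓓(Ω, ℂ)) : Prop :=
  ∀ᶠ x in 𝓝ˢ (sourceSupport F), ψ x = 1

/-- The functional `ℓ` on `H^{1/2}(∂Ω)` is the Neumann derivative `∂u/∂ν|_∂Ω` of the solution `u` of
`Δu + k² u = F`: if `w ∈ H¹(Ω)` lifts `g`, then
`ℓ g = ∫_Ω ∇u·∇w - k² ∫_Ω u w + F (ψ w)`, where `ψ` is any cut-off function for `F`. -/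
def HasNeumannDerivative {Ω : Opens Plane} (k : ℝ) (F : SobolevH1 Ω → ℂ) (u : SobolevH1 Ω)
    (ℓ : TraceSpace Ω → ℂ) : Prop :=
  ∀ ψ : 𝓓(Ω, ℂ), IsCutoffFor F ψ → ∀ (g : TraceSpace Ω) (w : SobolevH1 Ω),
    HasTrace w (g : BoundaryL2 Ω) → ℓ g = helmholtzForm k u w + F (w.cutoff ψ)

/-- `c` is the pair `(u|_∂Ω, ∂u/∂ν|_∂Ω)` of Cauchy data of the solution `u` of
`Δu + k² u = F`. -/
def HasCauchyData {Ω : Opens Plane} (k : ℝ) (F : SobolevH1 Ω → ℂ) (u : SobolevH1 Ω)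
    (c : BoundaryL2 Ω × (TraceSpace Ω → ℂ)) : Prop :=
  HasTrace u c.1 ∧ HasNeumannDerivative k F u c.2

/-! ### The sources -/

/-- The dipole-type source `F = ∇·(ρ χ_D a)`, that is `F(φ) = -∫_D ρ a·∇φ`. -/
noncomputable def dipoleSource {Ω : Opens Plane} (D : Set Plane) (ρ : Plane → ℂ) (a : Fin 2 → ℂ)
    (φ : SobolevH1 Ω) : ℂ :=
  - ∫ x in D, ρ x * ∑ i, a i * φ.grad i x

/-- Near the point `p`, the density `ρ` on `D` coincides (almost everywhere) with a
Hölder continuous function on a closed disk centred at `p` that does not vanish at `p`. -/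
def IsHolderNonvanishingAt (D : Set Plane) (ρ : Plane → ℂ) (p : Plane) : Prop :=
  ∃ (η : ℝ) (α C : ℝ≥0) (ρ' : Plane → ℂ), 0 < η ∧ 0 < α ∧ α ≤ 1 ∧
    HolderOnWith C α ρ' (Metric.closedBall p η) ∧
    (∀ᵐ x ∂(volume.restrict (Metric.ball p η ∩ D)), ρ x = ρ' x) ∧ ρ' p ≠ 0

/-- The standing assumptions on `(D, ρ)`: `D` is the inside of the simple polygon `P`, its closure
lies in `Ω`, `ρ ∈ L²(D)`, and `ρ` is Hölder continuous near each vertex and nonzero there. -/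
structure IsAdmissible (Ω : Opens Plane) {n : ℕ} [NeZero n] (P : Polygon Plane n) (D : Set Plane)
    (ρ : Plane → ℂ) : Prop where
  isPolygonInterior : IsPolygonInterior P D
  closure_subset : closure D ⊆ Ω
  memLp : MemLp ρ 2 (volume.restrict D)
  vertices : ∀ i, IsHolderNonvanishingAt D ρ (P i)

/-! The Cauchy data are tested against the exponentials `exp (ζ · x)` with complex `ζ` and `ζ · ζ =
-k²`, which solve the homogeneous Helmholtz equation. Equal data give, for every such `ζ`, `(a₁ · ζ)
∫_{D₁} ρ₁ exp (ζ · x) = (a₂ · ζ) ∫_{D₂} ρ₂ exp (ζ · x)`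
(`integral_mul_planeExp_eq_of_cauchyData_eq`).

Let `K` be the convex hull of all the vertices and suppose that an extreme point `p` of `K` lies
outside the hull of `P₂`. Then `p` is a vertex of `P₁`, and some linear `f` satisfies `f (x - p) ≥ c
|x - p|` on `K` (`exists_exposing_functional`). Take `ζ` with `Re ζ = -τ f` and let `τ → ∞`. After
removing the factor `exp (ζ · p)`, everything at positive distance from `p`, in particular all of
`D₂`, contributes exponentially little (`tendsto_sq_mul_integral_planeExp_zero`). Near `p` the
polygon `D₁` is a convex sector (`IsPolygonInterior.exists_corner`), and rescaling by `τ` shows that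
`τ²` times its contribution tends to a nonzero multiple of `ρ₁(p)`
(`tendsto_sq_mul_integral_corner`). The directions of `ζ` can be chosen with `lim (a₁ · ζ) / τ ≠ 0`
(`exists_frequencies`), which contradicts the identity. By symmetry all extreme points of `K` lie in
both hulls, so both hulls equal `K`.

The identity itself needs equal traces to remove the `u`-terms (`helmholtzForm_ofSmooth_eq`). Since
traces are limits of smooth boundary values, an estimate suffices in place of the divergence
theorem: `|∫_Ω ∂ᵢ h| ≤ C ∫_{∂Ω} |h|` (`IsLipschitzDomain.exists_norm_integral_pderiv_le`). It comes
from difference quotients, whose integrals over `Ω` only see a thin strip around `∂Ω`. -/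

/-! ### Coordinates on the plane -/

theorem dist_le_abs_add_abs (x y : Plane) : dist x y ≤ |x 0 - y 0| + |x 1 - y 1| := by
  rw [EuclideanSpace.dist_eq, Fin.sum_univ_two, Real.dist_eq, Real.dist_eq]
  refine Real.sqrt_le_iff.2 ⟨by positivity, ?_⟩
  nlinarith [abs_nonneg (x 0 - y 0), abs_nonneg (x 1 - y 1)]

theorem abs_sub_apply_le_dist (x y : Plane) (i : Fin 2) : |x i - y i| ≤ dist x y := by
  rw [dist_eq_norm]
  exact PiLp.norm_apply_le (x - y) i

/-- The plane as a product of two lines. -/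
noncomputable def planeProd : Plane ≃L[ℝ] ℝ × ℝ :=
  (EuclideanSpace.equiv (Fin 2) ℝ).trans (ContinuousLinearEquiv.finTwoArrow ℝ ℝ)

theorem planeProd_apply (x : Plane) : planeProd x = (x 0, x 1) := rfl

theorem measurePreserving_planeProd : MeasurePreserving planeProd := by
  have h1 := PiLp.volume_preserving_ofLp (Fin 2)
  have h2 := volume_preserving_finTwoArrow ℝ
  exact h2.comp h1

/-! ### Local charts of a Lipschitz boundary -/

section Chart

variable {Ω : Opens Plane} {L : Plane ≃ₗᵢ[ℝ] Plane} {γ : ℝ → ℝ} {K : ℝ≥0} {p : Plane} {r : ℝ}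

/-- A point strictly above the graph has a neighbourhood outside `Ω`; a point on the graph enters
`Ω` when pushed down. -/
theorem mem_frontier_iff_of_chart (hγ : Continuous γ)
    (hch : ∀ x ∈ Metric.ball p r, (x ∈ Ω ↔ (L x) 1 < γ ((L x) 0))) {z : Plane}
    (hz : z ∈ Metric.ball p r) :
    z ∈ frontier (Ω : Set Plane) ↔ (L z) 1 = γ ((L z) 0) := by
  have hL (i : Fin 2) : Continuous fun x => (L x) i :=
    (EuclideanSpace.proj i : Plane →L[ℝ] ℝ).continuous.comp L.continuous
  rw [frontier_eq_closure_inter_closure, closure_compl, Ω.isOpen.interior_eq]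
  constructor
  · rintro ⟨h1, h2⟩
    have h3 : ¬ (L z) 1 < γ ((L z) 0) := fun h => h2 ((hch z hz).2 h)
    refine le_antisymm ?_ (not_lt.1 h3)
    by_contra! h4
    have h5 : ∀ᶠ x in 𝓝 z, γ ((L x) 0) < (L x) 1 :=
      (hγ.comp (hL 0)).continuousAt.eventually_lt (hL 1).continuousAt h4
    obtain ⟨x, hxΩ, hx, hxb⟩ := ((mem_closure_iff_frequently.1 h1).and_eventually
      (h5.and (Metric.isOpen_ball.mem_nhds hz))).exists
    exact lt_asymm hx ((hch x hxb).1 hxΩ)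
  · intro h
    refine ⟨?_, fun h' => ((hch z hz).1 h').ne h⟩
    -- The upward vertical direction of the chart; `z - s • w` lies below the graph for `s > 0`.
    set w : Plane := L.symm (EuclideanSpace.single 1 1)
    have ht : Tendsto (fun s : ℝ => z - s • w) (𝓝[>] 0) (𝓝 z) := by
      have : Continuous fun s : ℝ => z - s • w := by fun_prop
      simpa using this.continuousWithinAt (s := Set.Ioi 0) (x := 0) |>.tendsto
    refine mem_closure_of_tendsto ht ?_
    filter_upwards [ht (Metric.isOpen_ball.mem_nhds hz), self_mem_nhdsWithin] with s hs hs0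
    refine (hch _ hs).2 ?_
    have : (0 : ℝ) < s := hs0
    simpa [w, h] using this

/-- Replacing `h x` by its value at the vertical projection of `x` to the graph costs at most `M *
c`. Fubini then gives a factor `2 * c`, the length of a vertical fibre. -/
theorem measure_strip_le {M : ℝ≥0} {h : Plane → ℂ} (hh : LipschitzWith M h) (hγ : Continuous γ)
    (a δ c : ℝ) {S : Set Plane} (hSm : MeasurableSet S)
    (hS : ∀ x ∈ S, (L x) 0 ∈ Set.Ioo (a - δ) (a + δ) ∧ |(L x) 1 - γ ((L x) 0)| ≤ c) :
    ∫⁻ x in S, ‖h x‖ₑ ≤ ENNReal.ofReal (2 * c) *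
      ((∫⁻ s in Set.Ioo (a - δ) (a + δ), ‖h (L.symm (planeProd.symm (s, γ s)))‖ₑ)
        + ENNReal.ofReal (2 * δ) * (M * ENNReal.ofReal c)) := by
  set G : ℝ → ℝ≥0∞ := fun s => ‖h (L.symm (planeProd.symm (s, γ s)))‖ₑ with hG
  have hGm : Measurable G := by
    have : Continuous fun s => h (L.symm (planeProd.symm (s, γ s))) := by
      have := hh.continuous
      have := L.symm.continuous
      fun_prop
    exact this.enorm.measurable
  set I := Set.Ioo (a - δ) (a + δ)
  set W : Set (ℝ × ℝ) := {q | q.1 ∈ I ∧ |q.2 - γ q.1| ≤ c} with hW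
  have hWm : MeasurableSet W :=
    (measurableSet_Ioo.preimage measurable_fst).inter
      (measurableSet_le (f := fun q : ℝ × ℝ => |q.2 - γ q.1|) (by fun_prop) measurable_const)
  have hT : MeasurePreserving (fun x => planeProd (L x)) :=
    measurePreserving_planeProd.comp L.measurePreserving
  set f : ℝ × ℝ → ℝ≥0∞ := W.indicator fun q => G q.1 + M * ENNReal.ofReal c with hf
  have hfm : Measurable f :=
    ((hGm.comp measurable_fst).add measurable_const).indicator hWm
  have hpt : ∀ x ∈ S, ‖h x‖ₑ ≤ f (planeProd (L x)) := by
    intro x hx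
    have hxW : planeProd (L x) ∈ W := hS x hx
    rw [hf, Set.indicator_of_mem hxW]
    set y := L.symm (planeProd.symm ((L x) 0, γ ((L x) 0))) with hy
    have hLy : planeProd (L y) = ((L x) 0, γ ((L x) 0)) := by simp [hy]
    rw [planeProd_apply, Prod.mk.injEq] at hLy
    have hd : edist x y ≤ ENNReal.ofReal c := by
      rw [edist_dist, ← L.dist_map]
      refine ENNReal.ofReal_le_ofReal ((dist_le_abs_add_abs _ _).trans ?_)
      rw [hLy.1, hLy.2]
      simpa using (hS x hx).2
    calc ‖h x‖ₑ ≤ ‖h y‖ₑ + ‖h x - h y‖ₑ := by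
          have := enorm_add_le (h y) (h x - h y)
          rwa [add_sub_cancel] at this
      _ ≤ G (planeProd (L x)).1 + M * ENNReal.ofReal c := by
          refine add_le_add (le_of_eq rfl) ?_
          rw [← edist_eq_enorm_sub]
          exact (hh x y).trans (by gcongr)
  calc ∫⁻ x in S, ‖h x‖ₑ ≤ ∫⁻ x in S, f (planeProd (L x)) :=
        setLIntegral_mono' hSm hpt
    _ ≤ ∫⁻ x, f (planeProd (L x)) := setLIntegral_le_lintegral _ _
    _ = ∫⁻ q, f q := hT.lintegral_comp hfm
    _ = ∫⁻ s, ∫⁻ b, f (s, b) := by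
        rw [Measure.volume_eq_prod, lintegral_prod _ hfm.aemeasurable]
    _ = ∫⁻ s, I.indicator (fun s => ENNReal.ofReal (2 * c) * (G s + M * ENNReal.ofReal c)) s := by
        refine lintegral_congr fun s => ?_
        by_cases hs : s ∈ I
        · have : (fun b => f (s, b)) =
              (Set.Icc (γ s - c) (γ s + c)).indicator fun _ => G s + M * ENNReal.ofReal c := by
            funext b
            have : (s, b) ∈ W ↔ b ∈ Set.Icc (γ s - c) (γ s + c) := by
              simp only [hW, Set.mem_ofPred_eq, hs, true_and, Set.mem_Icc, abs_le]
              constructor <;> rintro ⟨h1, h2⟩ <;> constructor <;> linarith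
            by_cases hb : b ∈ Set.Icc (γ s - c) (γ s + c)
            · rw [hf, Set.indicator_of_mem hb, Set.indicator_of_mem (this.2 hb)]
            · rw [hf, Set.indicator_of_notMem hb, Set.indicator_of_notMem (fun h => hb (this.1 h))]
          rw [this, lintegral_indicator measurableSet_Icc, setLIntegral_const, Real.volume_Icc,
            Set.indicator_of_mem hs, mul_comm]
          congr 2
          ring
        · have : (fun b => f (s, b)) = fun _ => 0 := by
            funext b
            exact Set.indicator_of_notMem (fun h => hs h.1) _
          rw [this, Set.indicator_of_notMem hs, lintegral_zero]
    _ = _ := by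
        rw [lintegral_indicator measurableSet_Ioo, lintegral_const_mul _ (by fun_prop),
          lintegral_add_right _ measurable_const, setLIntegral_const, Real.volume_Ioo]
        rw [mul_comm (M * ENNReal.ofReal c), show a + δ - (a - δ) = 2 * δ by ring]

/-- The first chart coordinate is 1-Lipschitz, so it does not increase one-dimensional Hausdorff
measure. This one-sided comparison suffices, and no area formula for the graph is needed. -/
theorem lintegral_graph_le (hγ : Continuous γ)
    (hch : ∀ x ∈ Metric.ball p r, (x ∈ Ω ↔ (L x) 1 < γ ((L x) 0))) {I : Set ℝ}
    (hIr : ∀ s ∈ I, L.symm (planeProd.symm (s, γ s)) ∈ Metric.ball p r) {g : Plane → ℝ≥0∞}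
    (hg : Measurable g) :
    ∫⁻ s in I, g (L.symm (planeProd.symm (s, γ s))) ≤ ∫⁻ x, g x ∂boundaryMeasure Ω := by
  set G : ℝ → Plane := fun s => L.symm (planeProd.symm (s, γ s)) with hGdef
  have hG : Continuous G := by
    have := L.symm.continuous
    fun_prop
  have hLG (s : ℝ) : planeProd (L (G s)) = (s, γ s) := by simp [hGdef]
  have hG0 (s : ℝ) : (L (G s)) 0 = s := congrArg Prod.fst (hLG s)
  have hG1 (s : ℝ) : (L (G s)) 1 = γ s := congrArg Prod.snd (hLG s)
  have hle : Measure.map G (volume.restrict I) ≤ boundaryMeasure Ω := by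
    refine Measure.le_iff.2 fun A hA => ?_
    rw [Measure.map_apply hG.measurable hA, Measure.restrict_apply (hG.measurable hA),
      boundaryMeasure, Measure.restrict_apply hA, ← hausdorffMeasure_real]
    have hlip : LipschitzWith 1 fun x : Plane => (L x) 0 :=
      LipschitzWith.of_dist_le_mul fun x y => by
        rw [NNReal.coe_one, one_mul, ← L.dist_map x y, Real.dist_eq]
        exact abs_sub_apply_le_dist _ _ 0
    calc Measure.hausdorffMeasure 1 (G ⁻¹' A ∩ I)
        ≤ Measure.hausdorffMeasure 1 ((fun x : Plane => (L x) 0) ''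
            (A ∩ frontier (Ω : Set Plane))) := by
          refine measure_mono fun s hs => ⟨G s, ⟨hs.1, ?_⟩, hG0 s⟩
          exact (mem_frontier_iff_of_chart hγ hch (hIr s hs.2)).2 (by rw [hG0, hG1])
      _ ≤ _ := by
          simpa using hlip.hausdorffMeasure_image_le zero_le_one
            (A ∩ frontier (Ω : Set Plane))
  calc ∫⁻ s in I, g (G s) = ∫⁻ x, g x ∂Measure.map G (volume.restrict I) :=
        (lintegral_map hg hG.measurable).symm
    _ ≤ _ := lintegral_mono' hle le_rfl

end Chart

/-! ### Integrals over thin strips around the boundary. -/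

/-- In the chart, a point within `t` of the graph of a `K`-Lipschitz function has vertical distance
at most `(1 + K) * t` from it, so `measure_strip_le` applies. Boundary length is locally finite
because the graph map is `(1 + K)`-Lipschitz. -/
theorem IsLipschitzDomain.exists_local_strip_bound {Ω : Opens Plane} (hΩ : IsLipschitzDomain Ω)
    {p : Plane} (hp : p ∈ frontier (Ω : Set Plane)) :
    ∃ U : Set Plane, IsOpen U ∧ p ∈ U ∧ boundaryMeasure Ω U < ⊤ ∧ ∃ (C : ℝ≥0) (t₀ : ℝ), 0 < t₀ ∧
      ∀ (M : ℝ≥0) (h : Plane → ℂ), LipschitzWith M h → ∀ t : ℝ, 0 < t → t < t₀ →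
        ∫⁻ x in Metric.cthickening t (frontier (Ω : Set Plane)) ∩ U, ‖h x‖ₑ ≤
          C * ENNReal.ofReal t * ((∫⁻ x, ‖h x‖ₑ ∂boundaryMeasure Ω) + M * ENNReal.ofReal t) := by
  obtain ⟨L, γ, K, hK, hev⟩ := hΩ.lipschitz_boundary p hp
  obtain ⟨r, hr, hch⟩ := Metric.eventually_nhds_iff_ball.1 hev
  have hγ := hK.continuous
  have hpc := (mem_frontier_iff_of_chart hγ hch (Metric.mem_ball_self hr)).1 hp
  -- With `(1 + K) * δ = r / 2`, the graph over the `δ`-interval stays in the ball where the chart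
  -- is valid.
  set δ : ℝ := r / (2 * (1 + K)) with hδ
  have hK0 : (0 : ℝ) ≤ K := K.2
  have hδ0 : 0 < δ := by positivity
  have hδr : (1 + K) * δ < r := by
    rw [hδ]; field_simp; linarith
  have hδr' : δ < r := by nlinarith
  have hKd (s s' : ℝ) : |γ s - γ s'| ≤ K * |s - s'| := by
    simpa [Real.dist_eq] using hK.dist_le_mul s s'
  set I := Set.Ioo ((L p) 0 - δ) ((L p) 0 + δ) with hIdef
  set G : ℝ → Plane := fun s => L.symm (planeProd.symm (s, γ s)) with hGdef
  have hLG (s : ℝ) : planeProd (L (G s)) = (s, γ s) := by simp [hGdef]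
  have hG0 (s : ℝ) : (L (G s)) 0 = s := congrArg Prod.fst (hLG s)
  have hG1 (s : ℝ) : (L (G s)) 1 = γ s := congrArg Prod.snd (hLG s)
  have hIr : ∀ s ∈ I, G s ∈ Metric.ball p r := by
    intro s hs
    rw [Metric.mem_ball, ← L.dist_map]
    have hs' : |s - (L p) 0| ≤ δ := by
      rw [abs_le]; constructor <;> linarith [hs.1, hs.2]
    refine ((dist_le_abs_add_abs _ _).trans ?_).trans_lt hδr
    rw [hG0, hG1, hpc]
    nlinarith [hKd s ((L p) 0)]
  have hI0 : ∀ x ∈ Metric.ball p δ, (L x) 0 ∈ I := by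
    intro x hx
    have h1 := abs_sub_apply_le_dist (L x) (L p) 0
    rw [L.dist_map] at h1
    have h2 := abs_lt.1 (h1.trans_lt hx)
    constructor <;> linarith [h2.1, h2.2]
  have hKG : LipschitzWith (1 + K) G := LipschitzWith.of_dist_le_mul fun s s' => by
    rw [← L.dist_map]
    refine (dist_le_abs_add_abs _ _).trans ?_
    rw [hG0, hG1, hG0, hG1, Real.dist_eq, NNReal.coe_add, NNReal.coe_one]
    linarith [hKd s s']
  -- Radius and thickness below `δ / 2` keep the nearby boundary point inside the chart. The factor
  -- `1 + 2 * δ * (1 + K)` dominates the coefficients of both the boundary integral and the error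
  -- term.
  refine ⟨Metric.ball p (δ / 2), Metric.isOpen_ball, Metric.mem_ball_self (by positivity), ?_,
    Real.toNNReal (2 * (1 + K) * (1 + 2 * δ * (1 + K))), δ / 2, by positivity,
    fun M h hh t ht htδ => ?_⟩
  · rw [boundaryMeasure, Measure.restrict_apply Metric.isOpen_ball.measurableSet]
    calc Measure.hausdorffMeasure 1 (Metric.ball p (δ / 2) ∩ frontier (Ω : Set Plane))
        ≤ Measure.hausdorffMeasure 1 (G '' I) := by
          refine measure_mono fun x hx => ?_
          have hxδ : x ∈ Metric.ball p δ := Metric.ball_subset_ball (by linarith) hx.1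
          refine ⟨(L x) 0, hI0 x hxδ, L.injective (planeProd.injective ?_)⟩
          rw [hLG, planeProd_apply,
            (mem_frontier_iff_of_chart hγ hch (Metric.ball_subset_ball hδr'.le hxδ)).1 hx.2]
      _ ≤ _ := hKG.hausdorffMeasure_image_le zero_le_one I
      _ < ⊤ := by
          rw [hausdorffMeasure_real, hIdef, Real.volume_Ioo]
          exact ENNReal.mul_lt_top (ENNReal.rpow_lt_top_of_nonneg zero_le_one ENNReal.coe_ne_top)
            ENNReal.ofReal_lt_top
  · have hc : IsCompact (frontier (Ω : Set Plane)) :=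
      Metric.isCompact_of_isClosed_isBounded isClosed_frontier
        (hΩ.isBounded.closure.subset frontier_subset_closure)
    have hS : ∀ x ∈ Metric.cthickening t (frontier (Ω : Set Plane)) ∩ Metric.ball p (δ / 2),
        (L x) 0 ∈ I ∧ |(L x) 1 - γ ((L x) 0)| ≤ (1 + K) * t := by
      rintro x ⟨hx, hxb⟩
      refine ⟨hI0 x (Metric.ball_subset_ball (by linarith) hxb), ?_⟩
      rw [hc.cthickening_eq_biUnion_closedBall ht.le] at hx
      obtain ⟨z, hz, hxz⟩ := Set.mem_iUnion₂.1 hx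
      rw [Metric.mem_closedBall] at hxz
      rw [Metric.mem_ball] at hxb
      have hzb : z ∈ Metric.ball p r := by
        rw [Metric.mem_ball]
        have := dist_triangle_left z p x
        linarith
      have hz' := (mem_frontier_iff_of_chart hγ hch hzb).1 hz
      have h0 := abs_sub_apply_le_dist (L x) (L z) 0
      have h1 := abs_sub_apply_le_dist (L x) (L z) 1
      rw [L.dist_map] at h0 h1
      have h2 := hKd ((L z) 0) ((L x) 0)
      rw [abs_sub_comm ((L z) 0)] at h2
      have h3 := abs_sub_le ((L x) 1) ((L z) 1) (γ ((L x) 0))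
      have h4 : K * |(L x) 0 - (L z) 0| ≤ K * t := by gcongr; exact h0.trans hxz
      rw [← hz'] at h2
      linarith
    have hSm : MeasurableSet
        (Metric.cthickening t (frontier (Ω : Set Plane)) ∩ Metric.ball p (δ / 2)) :=
      Metric.isClosed_cthickening.measurableSet.inter Metric.isOpen_ball.measurableSet
    refine (measure_strip_le hh hγ ((L p) 0) δ ((1 + K) * t) hSm hS).trans ?_
    have hg := lintegral_graph_le hγ hch hIr hh.continuous.enorm.measurable
    have e1 : ENNReal.ofReal (2 * ((1 + K) * t)) =
        ENNReal.ofReal (2 * (1 + K)) * ENNReal.ofReal t := by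
      rw [← ENNReal.ofReal_mul (by positivity), mul_assoc]
    have e2 : ENNReal.ofReal (2 * δ) * (M * ENNReal.ofReal ((1 + K) * t)) =
        ENNReal.ofReal (2 * δ * (1 + K)) * (M * ENNReal.ofReal t) := by
      rw [ENNReal.ofReal_mul (p := 1 + (K : ℝ)) (by positivity),
        ENNReal.ofReal_mul (p := 2 * δ) (by positivity)]
      ring
    have e3 : (Real.toNNReal (2 * (1 + K) * (1 + 2 * δ * (1 + K))) : ℝ≥0∞) =
        ENNReal.ofReal (2 * (1 + K)) * ENNReal.ofReal (1 + 2 * δ * (1 + K)) := by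
      rw [← ENNReal.ofReal_mul (by positivity), ENNReal.ofReal]
    have h1 : (1 : ℝ≥0∞) ≤ ENNReal.ofReal (1 + 2 * δ * (1 + K)) := by
      rw [← ENNReal.ofReal_one]
      exact ENNReal.ofReal_le_ofReal (le_add_of_nonneg_right (by positivity))
    have h2 : ENNReal.ofReal (2 * δ * (1 + K)) ≤ ENNReal.ofReal (1 + 2 * δ * (1 + K)) :=
      ENNReal.ofReal_le_ofReal (by linarith)
    rw [e1, e2, e3]
    calc _ ≤ ENNReal.ofReal (2 * (1 + K)) * ENNReal.ofReal t *
          (ENNReal.ofReal (1 + 2 * δ * (1 + K)) * (∫⁻ x, ‖h x‖ₑ ∂boundaryMeasure Ω) +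
            ENNReal.ofReal (1 + 2 * δ * (1 + K)) * (M * ENNReal.ofReal t)) :=
          mul_le_mul_right (add_le_add (hg.trans (le_mul_of_one_le_left' h1))
            (mul_le_mul_left h2 _)) _
      _ = _ := by ring

theorem IsLipschitzDomain.isCompact_frontier {Ω : Opens Plane} (hΩ : IsLipschitzDomain Ω) :
    IsCompact (frontier (Ω : Set Plane)) :=
  Metric.isCompact_of_isClosed_isBounded isClosed_frontier
    (hΩ.isBounded.closure.subset frontier_subset_closure)

theorem IsLipschitzDomain.isFiniteMeasure_boundaryMeasure {Ω : Opens Plane}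
    (hΩ : IsLipschitzDomain Ω) : IsFiniteMeasure (boundaryMeasure Ω) := by
  choose! U hU hpU hμ _ using fun p (hp : p ∈ frontier (Ω : Set Plane)) =>
    hΩ.exists_local_strip_bound hp
  have h1 : boundaryMeasure Ω (frontier (Ω : Set Plane)) < ⊤ :=
    hΩ.isCompact_frontier.measure_lt_top_of_nhdsWithin fun p hp =>
      ⟨U p, mem_nhdsWithin_of_mem_nhds ((hU p hp).mem_nhds (hpU p hp)), hμ p hp⟩
  refine ⟨?_⟩
  rw [boundaryMeasure, Measure.restrict_apply_univ]
  rwa [boundaryMeasure, Measure.restrict_apply_self] at h1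

/-- The local bounds add up over a finite cover of the compact boundary, and a thin enough strip
lies inside the cover. -/
theorem IsLipschitzDomain.exists_strip_bound {Ω : Opens Plane} (hΩ : IsLipschitzDomain Ω) :
    ∃ (C : ℝ≥0) (t₀ : ℝ), 0 < t₀ ∧
      ∀ (M : ℝ≥0) (h : Plane → ℂ), LipschitzWith M h → ∀ t : ℝ, 0 < t → t < t₀ →
        ∫⁻ x in Metric.cthickening t (frontier (Ω : Set Plane)), ‖h x‖ₑ ≤
          C * ENNReal.ofReal t * ((∫⁻ x, ‖h x‖ₑ ∂boundaryMeasure Ω) + M * ENNReal.ofReal t) := by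
  obtain ⟨U, hUo, hU, C, t₀, ht₀, H⟩ : ∃ U : Set Plane, IsOpen U ∧ frontier (Ω : Set Plane) ⊆ U ∧
      ∃ (C : ℝ≥0) (t₀ : ℝ), 0 < t₀ ∧
      ∀ (M : ℝ≥0) (h : Plane → ℂ), LipschitzWith M h → ∀ t : ℝ, 0 < t → t < t₀ →
        ∫⁻ x in Metric.cthickening t (frontier (Ω : Set Plane)) ∩ U, ‖h x‖ₑ ≤
          C * ENNReal.ofReal t * ((∫⁻ x, ‖h x‖ₑ ∂boundaryMeasure Ω) + M * ENNReal.ofReal t) := by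
    refine hΩ.isCompact_frontier.induction_on (p := fun s => ∃ U : Set Plane, IsOpen U ∧ s ⊆ U ∧
      ∃ (C : ℝ≥0) (t₀ : ℝ), 0 < t₀ ∧
      ∀ (M : ℝ≥0) (h : Plane → ℂ), LipschitzWith M h → ∀ t : ℝ, 0 < t → t < t₀ →
        ∫⁻ x in Metric.cthickening t (frontier (Ω : Set Plane)) ∩ U, ‖h x‖ₑ ≤
          C * ENNReal.ofReal t * ((∫⁻ x, ‖h x‖ₑ ∂boundaryMeasure Ω) + M * ENNReal.ofReal t))
      ⟨∅, isOpen_empty, le_rfl, 0, 1, one_pos, by simp⟩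
      (fun s t hst ⟨U, hUo, hU, h⟩ => ⟨U, hUo, hst.trans hU, h⟩) ?_ ?_
    · rintro s s' ⟨U, hUo, hU, C, t₀, ht₀, H⟩ ⟨U', hUo', hU', C', t₀', ht₀', H'⟩
      refine ⟨U ∪ U', hUo.union hUo', Set.union_subset_union hU hU', C + C', min t₀ t₀',
        lt_min ht₀ ht₀', fun M h hh t ht htt => ?_⟩
      rw [Set.inter_union_distrib_left, ENNReal.coe_add, add_mul, add_mul]
      exact (lintegral_union_le _ _ _).trans
        (add_le_add (H M h hh t ht (htt.trans_le (min_le_left _ _)))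
          (H' M h hh t ht (htt.trans_le (min_le_right _ _))))
    · intro p hp
      obtain ⟨U, hUo, hpU, -, h⟩ := hΩ.exists_local_strip_bound hp
      exact ⟨U, mem_nhdsWithin_of_mem_nhds (hUo.mem_nhds hpU), U, hUo, le_rfl, h⟩
  obtain ⟨δ, hδ, hδU⟩ := hΩ.isCompact_frontier.exists_cthickening_subset_open hUo hU
  refine ⟨C, min t₀ δ, lt_min ht₀ hδ, fun M h hh t ht htt => ?_⟩
  have := H M h hh t ht (htt.trans_le (min_le_left _ _))
  rwa [Set.inter_eq_left.2
    ((Metric.cthickening_mono (htt.le.trans (min_le_right _ _)) _).trans hδU)] at this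

/-! ### The divergence theorem on a Lipschitz domain, as an estimate -/

/-- Off the frontier, `D` and the exterior of its closure are open and disjoint. This serves for
segments crossing `∂Ω`, for rays leaving a bounded set, and for sectors at a corner. -/
theorem IsPreconnected.subset_of_disjoint_frontier {X : Type*} [TopologicalSpace X] {S D : Set X}
    (hS : IsPreconnected S) (hD : IsOpen D) (hd : Disjoint S (frontier D))
    (hne : (S ∩ D).Nonempty) : S ⊆ D := by
  refine hS.subset_left_of_subset_union hD isClosed_closure.isOpen_compl
    (Set.disjoint_compl_right_iff_subset.2 subset_closure) (fun x hx => ?_) hne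
  by_contra h
  rw [Set.mem_union, not_or, Set.mem_compl_iff, not_not] at h
  exact Set.disjoint_left.1 hd hx (by rw [hD.frontier_eq]; exact ⟨h.2, h.1⟩)

theorem mem_cthickening_frontier_of_segment {Ω : Opens Plane} {x y : Plane} {t : ℝ}
    (hxy : dist x y ≤ t) (h : ¬ (x ∈ Ω ↔ y ∈ Ω)) :
    x ∈ Metric.cthickening t (frontier (Ω : Set Plane)) := by
  have hseg : ¬ Disjoint (segment ℝ x y) (frontier (Ω : Set Plane)) := by
    intro hd
    have hsub := fun hne => (convex_segment x y).isPreconnected.subset_of_disjoint_frontier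
      Ω.isOpen hd hne
    exact h ⟨fun hx => hsub ⟨x, left_mem_segment ℝ x y, hx⟩ (right_mem_segment ℝ x y),
      fun hy => hsub ⟨y, right_mem_segment ℝ x y, hy⟩ (left_mem_segment ℝ x y)⟩
  obtain ⟨z, hz, hzf⟩ := Set.not_disjoint_iff.1 hseg
  refine Metric.mem_cthickening_of_dist_le x z t _ hzf (le_trans ?_ hxy)
  have h2 := dist_add_dist_of_mem_segment hz
  linarith [dist_nonneg (x := z) (y := y)]

/-- Moving the translation onto the domain leaves `h` times the difference of two indicators, which
vanishes unless the segment from `x - v` to `x` meets `∂Ω`. -/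
theorem norm_integral_translate_sub_le {Ω : Opens Plane} {h : Plane → ℂ} (hh : Continuous h)
    (hc : HasCompactSupport h) (v : Plane) :
    ‖∫ x in Ω, (h (x + v) - h x)‖ₑ ≤
      ∫⁻ x in Metric.cthickening ‖v‖ (frontier (Ω : Set Plane)), ‖h x‖ₑ := by
  have hint : Integrable h := hh.integrable_of_hasCompactSupport hc
  have hΩm : MeasurableSet (Ω : Set Plane) := Ω.isOpen.measurableSet
  have e1 : ∫ x in Ω, h (x + v) = ∫ x, (Ω : Set Plane).indicator 1 (x - v) * h x := by
    rw [← integral_indicator hΩm, ← integral_sub_right_eq_self _ v]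
    refine integral_congr_ae (Eventually.of_forall fun x => ?_)
    by_cases hx : x - v ∈ (Ω : Set Plane) <;> simp [hx]
  have e2 : ∫ x in Ω, h x = ∫ x, (Ω : Set Plane).indicator 1 x * h x := by
    rw [← integral_indicator hΩm]
    refine integral_congr_ae (Eventually.of_forall fun x => ?_)
    by_cases hx : x ∈ (Ω : Set Plane) <;> simp [hx]
  have hi2 : Integrable fun x => (Ω : Set Plane).indicator (1 : Plane → ℂ) x * h x := by
    refine (hint.indicator hΩm).congr (Eventually.of_forall fun x => ?_)
    by_cases hx : x ∈ (Ω : Set Plane) <;> simp [hx]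
  have hi1 : Integrable fun x => (Ω : Set Plane).indicator (1 : Plane → ℂ) (x - v) * h x := by
    refine (hint.indicator (hΩm.preimage (measurable_id.sub_const v))).congr
      (Eventually.of_forall fun x => ?_)
    by_cases hx : x - v ∈ (Ω : Set Plane)
    · simp only [hx, Set.indicator_of_mem, Pi.one_apply, one_mul]
      exact Set.indicator_of_mem (s := (fun x => id x - v) ⁻¹' (Ω : Set Plane)) hx h
    · simp only [hx, Set.indicator_of_notMem, not_false_eq_true, zero_mul]
      exact Set.indicator_of_notMem (s := (fun x => id x - v) ⁻¹' (Ω : Set Plane)) hx h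
  rw [integral_sub (hint.comp_add_right v).integrableOn hint.integrableOn, e1, e2,
    ← integral_sub hi1 hi2]
  refine (enorm_integral_le_lintegral_enorm _).trans ?_
  rw [← lintegral_indicator Metric.isClosed_cthickening.measurableSet]
  refine lintegral_mono fun x => ?_
  by_cases hx : x ∈ Metric.cthickening ‖v‖ (frontier (Ω : Set Plane))
  · rw [Set.indicator_of_mem hx, ← sub_mul, enorm_mul]
    refine mul_le_of_le_one_left' ?_
    rw [← ofReal_norm, ← ENNReal.ofReal_one]
    refine ENNReal.ofReal_le_ofReal ?_
    by_cases h1 : x - v ∈ (Ω : Set Plane) <;> by_cases h2 : x ∈ (Ω : Set Plane) <;> simp [h1, h2]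
  · have h1 : x ∈ (Ω : Set Plane) ↔ x - v ∈ (Ω : Set Plane) := by
      by_contra h1
      exact hx (mem_cthickening_frontier_of_segment (y := x - v) (by simp) h1)
    rw [Set.indicator_of_notMem hx]
    by_cases h2 : x ∈ (Ω : Set Plane) <;> simp [h2, h1.symm]

theorem exists_testFunction_eq_one {O : Opens Plane} {K : Set Plane} (hK : IsCompact K)
    (hKO : K ⊆ O) : ∃ χ : 𝓓(O, ℂ), ∀ᶠ x in 𝓝ˢ K, χ x = 1 := by
  obtain ⟨δ, hδ, hδO⟩ := hK.exists_cthickening_subset_open O.isOpen hKO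
  have hsub : K ⊆ interior (Metric.cthickening δ K) :=
    (Metric.self_subset_thickening hδ K).trans
      (interior_maximal (Metric.thickening_subset_cthickening _ _) Metric.isOpen_thickening)
  obtain ⟨f, hf1, hf0, -⟩ := exists_contMDiffMap_one_nhds_of_subset_interior (n := ⊤)
    (modelWithCornersSelf ℝ Plane) hK.isClosed hsub
  have hts : tsupport (fun x => (f x : ℂ)) ⊆ Metric.cthickening δ K := by
    refine closure_minimal (fun x hx => ?_) Metric.isClosed_cthickening
    by_contra h
    exact hx (by simp [hf0 x h])
  refine ⟨⟨fun x => (f x : ℂ), ?_, ?_, hts.trans hδO⟩, ?_⟩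
  · exact Complex.ofRealCLM.contDiff.comp f.contMDiff.contDiff
  · exact hK.cthickening.of_isClosed_subset (isClosed_tsupport _) hts
  · filter_upwards [hf1] with x hx
    change (f x : ℂ) = 1
    simp [hx]

theorem IsLipschitzDomain.isCompact_closure {Ω : Opens Plane} (hΩ : IsLipschitzDomain Ω) :
    IsCompact (closure (Ω : Set Plane)) :=
  Metric.isCompact_of_isClosed_isBounded isClosed_closure hΩ.isBounded.closure

theorem IsLipschitzDomain.isFiniteMeasure_restrict {Ω : Opens Plane} (hΩ : IsLipschitzDomain Ω) :
    IsFiniteMeasure (volume.restrict (Ω : Set Plane)) :=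
  ⟨by rw [Measure.restrict_apply_univ]; exact hΩ.isBounded.measure_lt_top⟩

/-- The integral is the limit of integrated difference quotients of step `t`. The strip bound of
order `t` compensates the division by `t`, and the Lipschitz constant of `h` enters only through a
term `M * t` that disappears, so `C` depends on `Ω` alone. -/
theorem IsLipschitzDomain.exists_norm_integral_pderiv_le_of_hasCompactSupport {Ω : Opens Plane}
    (hΩ : IsLipschitzDomain Ω) :
    ∃ C : ℝ≥0, ∀ h : Plane → ℂ, ContDiff ℝ 1 h → HasCompactSupport h → ∀ i,
      ‖∫ x in Ω, pderiv i h x‖ₑ ≤ C * ∫⁻ x, ‖h x‖ₑ ∂boundaryMeasure Ω := by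
  obtain ⟨C, t₀, ht₀, H⟩ := hΩ.exists_strip_bound
  have := hΩ.isFiniteMeasure_restrict
  refine ⟨C, fun h hh hc i => ?_⟩
  obtain ⟨M, hM⟩ := hh.lipschitzWith_of_hasCompactSupport hc (by simp)
  set v : Plane := EuclideanSpace.single i 1 with hv
  have hv1 : ‖v‖ = 1 := by simp [hv]
  have hlim : Tendsto (fun t : ℝ => ∫ x in Ω, t⁻¹ • (h (x + t • v) - h x)) (𝓝[>] 0)
      (𝓝 (∫ x in Ω, pderiv i h x)) := by
    refine tendsto_integral_filter_of_dominated_convergence (fun _ => (M : ℝ)) ?_ ?_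
      (integrable_const _) ?_
    · refine Eventually.of_forall fun t => Continuous.aestronglyMeasurable ?_
      have := hh.continuous
      fun_prop
    · filter_upwards [self_mem_nhdsWithin] with t ht
      have ht : (0 : ℝ) < t := ht
      refine Eventually.of_forall fun x => ?_
      have h1 := hM.dist_le_mul (x + t • v) x
      rw [dist_eq_norm, dist_self_add_left, norm_smul, hv1, mul_one, Real.norm_of_nonneg ht.le]
        at h1
      rw [norm_smul, norm_inv, Real.norm_of_nonneg ht.le, inv_mul_le_iff₀ ht, mul_comm t]
      exact h1
    · refine Eventually.of_forall fun x => ?_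
      have h1 := ((hh.differentiable (by simp) x).hasFDerivAt.hasLineDerivAt v)
      exact h1.tendsto_slope_zero_right
  have hlim2 : Tendsto (fun t : ℝ => C * ((∫⁻ x, ‖h x‖ₑ ∂boundaryMeasure Ω) +
      M * ENNReal.ofReal t)) (𝓝[>] 0) (𝓝 (C * ∫⁻ x, ‖h x‖ₑ ∂boundaryMeasure Ω)) := by
    have h1 : Tendsto (fun t : ℝ => ENNReal.ofReal t) (𝓝[>] 0) (𝓝 0) := by
      have := (ENNReal.continuous_ofReal.tendsto 0).mono_left
        (nhdsWithin_le_nhds (s := Set.Ioi (0 : ℝ)))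
      simpa using this
    have h2 := ENNReal.Tendsto.const_mul (a := (M : ℝ≥0∞)) h1 (Or.inr ENNReal.coe_ne_top)
    have h3 := ENNReal.Tendsto.const_mul (a := (C : ℝ≥0∞))
      ((tendsto_const_nhds (x := ∫⁻ x, ‖h x‖ₑ ∂boundaryMeasure Ω)).add h2)
      (Or.inr ENNReal.coe_ne_top)
    simpa using h3
  refine le_of_tendsto_of_tendsto hlim.enorm hlim2 ?_
  filter_upwards [self_mem_nhdsWithin, nhdsWithin_le_nhds (Iio_mem_nhds ht₀)] with t ht htt
  have ht : (0 : ℝ) < t := ht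
  have h1 := norm_integral_translate_sub_le (Ω := Ω) hh.continuous hc (t • v)
  rw [norm_smul, hv1, mul_one, Real.norm_of_nonneg ht.le] at h1
  rw [integral_smul, enorm_smul, enorm_inv ht.ne', Real.enorm_of_nonneg ht.le]
  have h2 := h1.trans (H M h hM t ht htt)
  calc _ ≤ (ENNReal.ofReal t)⁻¹ * (C * ENNReal.ofReal t *
        ((∫⁻ x, ‖h x‖ₑ ∂boundaryMeasure Ω) + M * ENNReal.ofReal t)) := mul_le_mul_right h2 _
    _ = ((ENNReal.ofReal t)⁻¹ * ENNReal.ofReal t) * (C *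
        ((∫⁻ x, ‖h x‖ₑ ∂boundaryMeasure Ω) + M * ENNReal.ofReal t)) := by ring
    _ = _ := by
        rw [ENNReal.inv_mul_cancel (by simpa using ht) ENNReal.ofReal_ne_top, one_mul]

theorem IsLipschitzDomain.exists_norm_integral_pderiv_le {Ω : Opens Plane}
    (hΩ : IsLipschitzDomain Ω) :
    ∃ C : ℝ≥0, ∀ h : Plane → ℂ, ContDiff ℝ 1 h → ∀ i,
      ‖∫ x in Ω, pderiv i h x‖ₑ ≤ C * ∫⁻ x, ‖h x‖ₑ ∂boundaryMeasure Ω := by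
  obtain ⟨C, hC⟩ := hΩ.exists_norm_integral_pderiv_le_of_hasCompactSupport
  obtain ⟨χ, hχ⟩ := exists_testFunction_eq_one (O := ⊤) hΩ.isCompact_closure (Set.subset_univ _)
  refine ⟨C, fun h hh i => ?_⟩
  have h1 := hC (fun x => χ x * h x) ((χ.contDiff.of_le (by simp)).mul hh)
    χ.hasCompactSupport.mul_right i
  have hχn : ∀ x ∈ closure (Ω : Set Plane), ∀ᶠ y in 𝓝 x, χ y = 1 := fun x hx =>
    hχ.filter_mono (nhds_le_nhdsSet hx)
  have e1 : ∫ x in Ω, pderiv i (fun x => χ x * h x) x = ∫ x in Ω, pderiv i h x := by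
    refine setIntegral_congr_fun Ω.isOpen.measurableSet fun x hx => ?_
    have : (fun x => χ x * h x) =ᶠ[𝓝 x] h := by
      filter_upwards [hχn x (subset_closure hx)] with y hy
      rw [hy, one_mul]
    simp only [pderiv, this.fderiv_eq]
  have e2 : ∫⁻ x, ‖χ x * h x‖ₑ ∂boundaryMeasure Ω = ∫⁻ x, ‖h x‖ₑ ∂boundaryMeasure Ω := by
    refine setLIntegral_congr_fun isClosed_frontier.measurableSet fun x hx => ?_
    simp only [(hχn x (frontier_subset_closure hx)).self_of_nhds, one_mul]
  rwa [e1, e2] at h1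

/-! ### Functions with equal traces, and the resulting identity for Helmholtz solutions -/

theorem tendsto_integral_mul_of_tendsto_eLpNorm {X : Type*} [MeasurableSpace X] {μ : Measure X}
    {f : ℕ → X → ℂ} {u φ : X → ℂ} (hf : ∀ m, MemLp (f m) 2 μ) (hu : MemLp u 2 μ)
    (hφ : MemLp φ 2 μ) (h : Tendsto (fun m => eLpNorm (fun x => f m x - u x) 2 μ) atTop (𝓝 0)) :
    Tendsto (fun m => ∫ x, f m x * φ x ∂μ) atTop (𝓝 (∫ x, u x * φ x ∂μ)) := by
  rw [tendsto_iff_edist_tendsto_0]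
  have hlim : Tendsto (fun m => eLpNorm (fun x => f m x - u x) 2 μ * eLpNorm φ 2 μ) atTop
      (𝓝 0) := by
    simpa using ENNReal.Tendsto.mul_const h (Or.inr hφ.eLpNorm_ne_top)
  refine tendsto_of_tendsto_of_tendsto_of_le_of_le tendsto_const_nhds hlim (fun _ => zero_le)
    fun m => ?_
  have e : ∫ x, f m x * φ x ∂μ - ∫ x, u x * φ x ∂μ = ∫ x, (f m x - u x) * φ x ∂μ := by
    simp only [sub_mul]
    exact (integral_sub ((hf m).integrable_mul hφ) (hu.integrable_mul hφ)).symm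
  dsimp only
  rw [edist_eq_enorm_sub, e]
  refine (enorm_integral_le_lintegral_enorm _).trans ?_
  rw [← eLpNorm_one_eq_lintegral_enorm]
  have := eLpNorm_le_eLpNorm_mul_eLpNorm'_of_norm (p := 2) (q := 2) (r := 1)
    ((hf m).sub hu).aestronglyMeasurable hφ.aestronglyMeasurable (fun a b : ℂ => a * b) 1
    (Eventually.of_forall fun x => by simp)
  rwa [ENNReal.coe_one, one_mul] at this

section

variable {Ω : Opens Plane}

theorem IsLipschitzDomain.memLp_of_continuous (hΩ : IsLipschitzDomain Ω) {f : Plane → ℂ}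
    (hf : Continuous f) (p : ℝ≥0∞) : MemLp f p (volume.restrict (Ω : Set Plane)) := by
  have := hΩ.isFiniteMeasure_restrict
  obtain ⟨C, hC⟩ := hΩ.isCompact_closure.exists_bound_of_continuousOn hf.continuousOn
  exact MemLp.of_bound hf.aestronglyMeasurable C (ae_restrict_of_forall_mem
    Ω.isOpen.measurableSet fun x hx => hC x (subset_closure hx))

theorem IsLipschitzDomain.memLp_boundary_of_continuous (hΩ : IsLipschitzDomain Ω) {f : Plane → ℂ}
    (hf : Continuous f) (p : ℝ≥0∞) : MemLp f p (boundaryMeasure Ω) := by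
  have := hΩ.isFiniteMeasure_boundaryMeasure
  obtain ⟨C, hC⟩ := hΩ.isCompact_frontier.exists_bound_of_continuousOn hf.continuousOn
  exact MemLp.of_bound hf.aestronglyMeasurable C (ae_restrict_of_forall_mem
    isClosed_frontier.measurableSet hC)

theorem pderiv_sub {f g : Plane → ℂ} (hf : ContDiff ℝ ∞ f) (hg : ContDiff ℝ ∞ g) (i : Fin 2)
    (x : Plane) : pderiv i (fun x => f x - g x) x = pderiv i f x - pderiv i g x := by
  rw [pderiv, fderiv_fun_sub (hf.differentiable (by simp) x) (hg.differentiable (by simp) x)]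
  rfl

theorem pderiv_mul {f g : Plane → ℂ} (hf : ContDiff ℝ ∞ f) (hg : ContDiff ℝ ∞ g) (i : Fin 2)
    (x : Plane) : pderiv i (fun x => f x * g x) x = f x * pderiv i g x + pderiv i f x * g x := by
  rw [pderiv, fderiv_fun_mul (hf.differentiable (by simp) x) (hg.differentiable (by simp) x)]
  simp [pderiv, mul_comm]

theorem tendsto_eLpNorm_sub_sub {X : Type*} [MeasurableSpace X] {μ : Measure X}
    {f g : ℕ → X → ℂ} {u v : X → ℂ} (hf : ∀ m, AEStronglyMeasurable (f m) μ)
    (hg : ∀ m, AEStronglyMeasurable (g m) μ) (hu : AEStronglyMeasurable u μ)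
    (hv : AEStronglyMeasurable v μ)
    (h1 : Tendsto (fun m => eLpNorm (fun x => f m x - u x) 2 μ) atTop (𝓝 0))
    (h2 : Tendsto (fun m => eLpNorm (fun x => g m x - v x) 2 μ) atTop (𝓝 0)) :
    Tendsto (fun m => eLpNorm (fun x => (f m x - g m x) - (u x - v x)) 2 μ) atTop (𝓝 0) := by
  have h3 := h1.add h2
  rw [add_zero] at h3
  refine tendsto_of_tendsto_of_tendsto_of_le_of_le tendsto_const_nhds h3 (fun _ => zero_le)
    fun m => ?_
  have e : (fun x => (f m x - g m x) - (u x - v x)) =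
      (fun x => f m x - u x) - fun x => g m x - v x := by
    funext x
    simp only [Pi.sub_apply]
    ring
  dsimp only
  rw [e]
  exact eLpNorm_sub_le ((hf m).sub hu) ((hg m).sub hv) (by norm_num)

/-- Smooth approximations `f m` of `u₁ - u₂` have boundary values tending to zero in `L²(∂Ω)`. Hence
`∫_Ω ∂ᵢ (f m * φ)`, bounded by the boundary integral of `|f m * φ|`, tends to zero, while by the
product rule it tends to the left-hand side. -/
theorem integral_grad_sub_mul_add_eq_zero (hΩ : IsLipschitzDomain Ω) {u₁ u₂ : SobolevH1 Ω}
    {g : BoundaryL2 Ω} (h₁ : HasTrace u₁ g) (h₂ : HasTrace u₂ g) {φ : Plane → ℂ}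
    (hφ : ContDiff ℝ ∞ φ) (i : Fin 2) :
    (∫ x in Ω, (u₁.grad i x - u₂.grad i x) * φ x) +
      ∫ x in Ω, (u₁.toFun x - u₂.toFun x) * pderiv i φ x = 0 := by
  obtain ⟨f₁, hf₁, ⟨hL₁, hG₁⟩, hB₁⟩ := h₁
  obtain ⟨f₂, hf₂, ⟨hL₂, hG₂⟩, hB₂⟩ := h₂
  have := hΩ.isFiniteMeasure_boundaryMeasure
  obtain ⟨C, hC⟩ := hΩ.exists_norm_integral_pderiv_le
  set f : ℕ → Plane → ℂ := fun m x => f₁ m x - f₂ m x with hfdef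
  have hf (m) : ContDiff ℝ ∞ (f m) := (hf₁ m).sub (hf₂ m)
  have hφ' := continuous_pderiv hφ i
  have hL : Tendsto (fun m => eLpNorm (fun x => f m x - (u₁.toFun x - u₂.toFun x)) 2
      (volume.restrict Ω)) atTop (𝓝 0) :=
    tendsto_eLpNorm_sub_sub (fun m => (hf₁ m).continuous.aestronglyMeasurable)
      (fun m => (hf₂ m).continuous.aestronglyMeasurable) u₁.memLp.aestronglyMeasurable
      u₂.memLp.aestronglyMeasurable hL₁ hL₂
  have hG : Tendsto (fun m => eLpNorm (fun x => pderiv i (f m) x -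
      (u₁.grad i x - u₂.grad i x)) 2 (volume.restrict Ω)) atTop (𝓝 0) := by
    simp only [hfdef, pderiv_sub (hf₁ _) (hf₂ _)]
    exact tendsto_eLpNorm_sub_sub (fun m => (continuous_pderiv (hf₁ m) i).aestronglyMeasurable)
      (fun m => (continuous_pderiv (hf₂ m) i).aestronglyMeasurable)
      (u₁.grad_memLp i).aestronglyMeasurable (u₂.grad_memLp i).aestronglyMeasurable (hG₁ i) (hG₂ i)
  have hB : Tendsto (fun m => eLpNorm (f m) 2 (boundaryMeasure Ω)) atTop (𝓝 0) := by
    have := tendsto_eLpNorm_sub_sub (fun m => (hf₁ m).continuous.aestronglyMeasurable)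
      (fun m => (hf₂ m).continuous.aestronglyMeasurable) (Lp.aestronglyMeasurable g)
      (Lp.aestronglyMeasurable g) hB₁ hB₂
    simpa only [sub_self, sub_zero] using this
  have hlim1 := (tendsto_integral_mul_of_tendsto_eLpNorm
      (fun m => hΩ.memLp_of_continuous (continuous_pderiv (hf m) i) 2)
      ((u₁.grad_memLp i).sub (u₂.grad_memLp i)) (hΩ.memLp_of_continuous hφ.continuous 2) hG).add
    (tendsto_integral_mul_of_tendsto_eLpNorm
      (fun m => hΩ.memLp_of_continuous (hf m).continuous 2)
      (u₁.memLp.sub u₂.memLp) (hΩ.memLp_of_continuous hφ' 2) hL)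
  have hlim2 : Tendsto (fun m => (∫ x in Ω, pderiv i (f m) x * φ x) +
      ∫ x in Ω, f m x * pderiv i φ x) atTop (𝓝 0) := by
    rw [tendsto_iff_edist_tendsto_0]
    simp only [edist_zero_right]
    have hφB := hΩ.memLp_boundary_of_continuous hφ.continuous 2
    have hlim : Tendsto (fun m => C * (eLpNorm (f m) 2 (boundaryMeasure Ω) *
        eLpNorm φ 2 (boundaryMeasure Ω))) atTop (𝓝 0) := by
      have h1 := ENNReal.Tendsto.mul_const hB (Or.inr hφB.eLpNorm_ne_top)
      simpa using ENNReal.Tendsto.const_mul (a := (C : ℝ≥0∞)) h1 (Or.inr ENNReal.coe_ne_top)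
    refine tendsto_of_tendsto_of_tendsto_of_le_of_le tendsto_const_nhds hlim (fun _ => zero_le)
      fun m => ?_
    have e : (∫ x in Ω, pderiv i (f m) x * φ x) + ∫ x in Ω, f m x * pderiv i φ x =
        ∫ x in Ω, pderiv i (fun x => f m x * φ x) x := by
      rw [← integral_add]
      · simp only [pderiv_mul (hf m) hφ, add_comm]
      · exact ((hΩ.memLp_of_continuous (continuous_pderiv (hf m) i) 2).integrable_mul
          (hΩ.memLp_of_continuous hφ.continuous 2))
      · exact ((hΩ.memLp_of_continuous (hf m).continuous 2).integrable_mul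
          (hΩ.memLp_of_continuous hφ' 2))
    dsimp only
    rw [e]
    refine (hC _ (((hf m).mul hφ).of_le (by simp)) i).trans (mul_le_mul_right ?_ _)
    rw [← eLpNorm_one_eq_lintegral_enorm]
    have := eLpNorm_le_eLpNorm_mul_eLpNorm'_of_norm (p := 2) (q := 2) (r := 1)
      (hΩ.memLp_boundary_of_continuous (hf m).continuous 2).aestronglyMeasurable
      hφB.aestronglyMeasurable (fun a b : ℂ => a * b) 1 (Eventually.of_forall fun x => by simp)
    simpa using this
  exact tendsto_nhds_unique hlim1 hlim2

/-- A smooth function on the plane, restricted to `Ω`, as an element of `H¹(Ω)`. -/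
noncomputable def SobolevH1.ofSmooth (hΩ : IsLipschitzDomain Ω) {w : Plane → ℂ}
    (hw : ContDiff ℝ ∞ w) : SobolevH1 Ω where
  toFun := w
  grad i := pderiv i w
  memLp := hΩ.memLp_of_continuous hw.continuous 2
  grad_memLp i := hΩ.memLp_of_continuous (continuous_pderiv hw i) 2
  weak_deriv φ i := by
    have h1 := continuous_pderiv hw i
    have h2 := continuous_pderiv φ.contDiff i
    rw [setIntegral_eq_integral_of_forall_compl_eq_zero (fun x hx => by
        rw [pderiv_eq_zero_of_notMem φ i hx, mul_zero]),
      setIntegral_eq_integral_of_forall_compl_eq_zero (fun x hx => by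
        rw [apply_eq_zero_of_notMem φ hx, mul_zero])]
    exact integral_mul_fderiv_eq_neg_fderiv_mul_of_integrable
      ((h1.mul φ.continuous).integrable_of_hasCompactSupport φ.hasCompactSupport.mul_left)
      ((hw.continuous.mul h2).integrable_of_hasCompactSupport
        (hasCompactSupport_pderiv φ.hasCompactSupport i).mul_left)
      ((hw.continuous.mul φ.continuous).integrable_of_hasCompactSupport
        φ.hasCompactSupport.mul_left)
      (fun x _ => hw.differentiable (by simp) x)
      (fun x _ => φ.contDiff.differentiable (by simp) x)

theorem SobolevH1.hasTrace_ofSmooth (hΩ : IsLipschitzDomain Ω) {w : Plane → ℂ}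
    (hw : ContDiff ℝ ∞ w) : HasTrace (SobolevH1.ofSmooth hΩ hw)
      ((hΩ.memLp_boundary_of_continuous hw.continuous 2).toLp w) := by
  refine ⟨fun _ => w, fun _ => hw, ⟨?_, fun i => ?_⟩, ?_⟩
  · simp [SobolevH1.ofSmooth]
  · simp [SobolevH1.ofSmooth]
  · have h : (fun x => w x - (hΩ.memLp_boundary_of_continuous hw.continuous 2).toLp w x)
        =ᵐ[boundaryMeasure Ω] 0 := by
      filter_upwards [(hΩ.memLp_boundary_of_continuous hw.continuous 2).coeFn_toLp] with x hx
      simp [hx]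
    simp only [eLpNorm_congr_ae h, eLpNorm_zero, tendsto_const_nhds]

/-- Since `-k² w = Δw`, the form is `∫ ∇u · ∇w + ∫ u Δw`. Integration by parts for `u₁ - u₂` against
each `pderiv i w` shows that it depends on `u` only through its trace. -/
theorem helmholtzForm_ofSmooth_eq (hΩ : IsLipschitzDomain Ω) {u₁ u₂ : SobolevH1 Ω}
    {g : BoundaryL2 Ω} (h₁ : HasTrace u₁ g) (h₂ : HasTrace u₂ g) {w : Plane → ℂ}
    (hw : ContDiff ℝ ∞ w) (hw' : ∀ i, ContDiff ℝ ∞ (pderiv i w)) {k : ℝ}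
    (hΔ : ∀ x, ∑ i, pderiv i (pderiv i w) x = -(k : ℂ) ^ 2 * w x) :
    helmholtzForm k u₁ (.ofSmooth hΩ hw) = helmholtzForm k u₂ (.ofSmooth hΩ hw) := by
  have hwL := hΩ.memLp_of_continuous hw.continuous 2
  have hwL' (i) := hΩ.memLp_of_continuous (hw' i).continuous 2
  have hwL'' (i) := hΩ.memLp_of_continuous (continuous_pderiv (hw' i) i) 2
  have i1 (u : SobolevH1 Ω) (i) :
      Integrable (fun x => u.grad i x * pderiv i w x) (volume.restrict (Ω : Set Plane)) :=
    (u.grad_memLp i).integrable_mul (hwL' i)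
  have i2 (u : SobolevH1 Ω) (i) : Integrable (fun x => u.toFun x * pderiv i (pderiv i w) x)
      (volume.restrict (Ω : Set Plane)) :=
    u.memLp.integrable_mul (hwL'' i)
  have key (i) := integral_grad_sub_mul_add_eq_zero hΩ h₁ h₂ (hw' i) i
  have key' (i) : (∫ x in Ω, u₁.grad i x * pderiv i w x) - (∫ x in Ω, u₂.grad i x * pderiv i w x)
      + ((∫ x in Ω, u₁.toFun x * pderiv i (pderiv i w) x)
        - ∫ x in Ω, u₂.toFun x * pderiv i (pderiv i w) x) = 0 := by
    rw [← integral_sub (i1 u₁ i) (i1 u₂ i), ← integral_sub (i2 u₁ i) (i2 u₂ i), ← key i]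
    simp only [sub_mul]
  have e1 (u : SobolevH1 Ω) : ∑ i, ∫ x in Ω, u.toFun x * pderiv i (pderiv i w) x =
      -(k : ℂ) ^ 2 * ∫ x in Ω, u.toFun x * w x := by
    rw [← integral_finsetSum _ (fun i _ => i2 u i), ← integral_const_mul]
    refine integral_congr_ae (Eventually.of_forall fun x => ?_)
    simp only [← Finset.mul_sum, hΔ]
    ring
  have e2 (u : SobolevH1 Ω) : helmholtzForm k u (.ofSmooth hΩ hw) =
      (∑ i, ∫ x in Ω, u.grad i x * pderiv i w x) +
        ∑ i, ∫ x in Ω, u.toFun x * pderiv i (pderiv i w) x := by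
    rw [helmholtzForm, e1, ← integral_finsetSum _ (fun i _ => i1 u i)]
    simp only [SobolevH1.ofSmooth]
    ring
  rw [e2, e2]
  simp only [Fin.sum_univ_two]
  linear_combination key' 0 + key' 1

theorem sourceSupport_dipoleSource_subset (D : Set Plane) (ρ : Plane → ℂ)
    (a : Fin 2 → ℂ) :
    sourceSupport (Ω := Ω) (dipoleSource D ρ a) ⊆ closure D := by
  rintro x ⟨-, hx⟩
  by_contra h
  obtain ⟨χ, hχ, hne⟩ := hx _ (isClosed_closure.isOpen_compl.mem_nhds h)
  refine hne ?_
  rw [dipoleSource, neg_eq_zero]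
  refine setIntegral_eq_zero_of_forall_eq_zero fun y hy => ?_
  have hy' : y ∉ tsupport (fderiv ℝ χ) := fun h' =>
    hχ (tsupport_fderiv_subset ℝ h') (subset_closure hy)
  simp [SobolevH1.ofTestFunction, pderiv, image_eq_zero_of_notMem_tsupport hy']

theorem dipoleSource_cutoff_ofSmooth (hΩ : IsLipschitzDomain Ω) {D : Set Plane} (hD : IsOpen D)
    (ρ : Plane → ℂ) (a : Fin 2 → ℂ) {ψ : 𝓓(Ω, ℂ)} (hψ : ∀ x ∈ D, ∀ᶠ y in 𝓝 x, ψ y = 1)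
    {w : Plane → ℂ} (hw : ContDiff ℝ ∞ w) :
    dipoleSource D ρ a ((SobolevH1.ofSmooth hΩ hw).cutoff ψ) =
      -∫ x in D, ρ x * ∑ i, a i * pderiv i w x := by
  rw [dipoleSource, neg_inj]
  refine setIntegral_congr_fun hD.measurableSet fun x hx => ?_
  have h0 (i) : pderiv i ψ x = 0 := by
    have : ψ =ᶠ[𝓝 x] fun _ => (1 : ℂ) := hψ x hx
    simp [pderiv, this.fderiv_eq]
  simp [SobolevH1.cutoff, SobolevH1.ofSmooth, h0, (hψ x hx).self_of_nhds]

/-- One cut-off equal to `1` near both closures is valid for both sources. The Helmholtz forms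
cancel, so only the source terms survive. -/
theorem integral_dipole_eq_of_cauchyData_eq (hΩ : IsLipschitzDomain Ω) {k : ℝ}
    {D₁ D₂ : Set Plane} {ρ₁ ρ₂ : Plane → ℂ} {a₁ a₂ : Fin 2 → ℂ} (hD₁ : IsOpen D₁)
    (hD₂ : IsOpen D₂) (hc₁ : closure D₁ ⊆ Ω) (hc₂ : closure D₂ ⊆ Ω) {u₁ u₂ : SobolevH1 Ω}
    {c : BoundaryL2 Ω × (TraceSpace Ω → ℂ)}
    (h₁ : HasCauchyData k (dipoleSource D₁ ρ₁ a₁) u₁ c)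
    (h₂ : HasCauchyData k (dipoleSource D₂ ρ₂ a₂) u₂ c) {w : Plane → ℂ}
    (hw : ContDiff ℝ ∞ w) (hw' : ∀ i, ContDiff ℝ ∞ (pderiv i w))
    (hΔ : ∀ x, ∑ i, pderiv i (pderiv i w) x = -(k : ℂ) ^ 2 * w x) :
    ∫ x in D₁, ρ₁ x * ∑ i, a₁ i * pderiv i w x = ∫ x in D₂, ρ₂ x * ∑ i, a₂ i * pderiv i w x := by
  have hK : IsCompact (closure D₁ ∪ closure D₂) :=
    hΩ.isCompact_closure.of_isClosed_subset (isClosed_closure.union isClosed_closure)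
      ((Set.union_subset hc₁ hc₂).trans subset_closure)
  obtain ⟨ψ, hψ⟩ := exists_testFunction_eq_one hK (Set.union_subset hc₁ hc₂)
  have hcut₁ : IsCutoffFor (Ω := Ω) (dipoleSource D₁ ρ₁ a₁) ψ := hψ.filter_mono
    (nhdsSet_mono ((sourceSupport_dipoleSource_subset D₁ ρ₁ a₁).trans Set.subset_union_left))
  have hcut₂ : IsCutoffFor (Ω := Ω) (dipoleSource D₂ ρ₂ a₂) ψ := hψ.filter_mono
    (nhdsSet_mono ((sourceSupport_dipoleSource_subset D₂ ρ₂ a₂).trans Set.subset_union_right))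
  have htr := SobolevH1.hasTrace_ofSmooth hΩ hw
  have e₁ := h₁.2 ψ hcut₁ ⟨_, _, htr⟩ _ htr
  have e₂ := h₂.2 ψ hcut₂ ⟨_, _, htr⟩ _ htr
  rw [e₁, helmholtzForm_ofSmooth_eq hΩ h₁.1 h₂.1 hw hw' hΔ, add_right_inj,
    dipoleSource_cutoff_ofSmooth hΩ hD₁ _ _ (fun x hx => hψ.filter_mono
      (nhds_le_nhdsSet (Set.mem_union_left _ (subset_closure hx)))),
    dipoleSource_cutoff_ofSmooth hΩ hD₂ _ _ (fun x hx => hψ.filter_mono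
      (nhds_le_nhdsSet (Set.mem_union_right _ (subset_closure hx)))), neg_inj] at e₂
  exact e₂

end

/-! ### Exponential solutions of the Helmholtz equation -/

/-- The exponential `x ↦ exp (ζ · x)`. -/
noncomputable def planeExp (ζ : Fin 2 → ℂ) (x : Plane) : ℂ := Complex.exp (∑ i, ζ i * x i)

theorem contDiff_planeExp (ζ : Fin 2 → ℂ) : ContDiff ℝ ∞ (planeExp ζ) := by
  refine ContDiff.cexp (ContDiff.sum fun i _ => contDiff_const.mul ?_)
  exact Complex.ofRealCLM.contDiff.comp (EuclideanSpace.proj i : Plane →L[ℝ] ℝ).contDiff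

theorem pderiv_const_mul_planeExp (c : ℂ) (ζ : Fin 2 → ℂ) (i : Fin 2) (x : Plane) :
    pderiv i (fun x => c * planeExp ζ x) x = c * ζ i * planeExp ζ x := by
  have hp (j : Fin 2) : HasFDerivAt (fun x : Plane => ((x j : ℝ) : ℂ))
      (Complex.ofRealCLM.comp (EuclideanSpace.proj j : Plane →L[ℝ] ℝ)) x :=
    (Complex.ofRealCLM.comp (EuclideanSpace.proj j : Plane →L[ℝ] ℝ)).hasFDerivAt
  have h := ((HasFDerivAt.fun_sum fun j (_ : j ∈ Finset.univ) =>
    (hp j).const_mul (ζ j)).cexp).const_mul c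
  have h' : fderiv ℝ (fun x => c * planeExp ζ x) x = _ := h.fderiv
  rw [pderiv, h']
  fin_cases i <;> simp [planeExp] <;> ring

theorem integral_mul_planeExp_eq_of_cauchyData_eq {Ω : Opens Plane} (hΩ : IsLipschitzDomain Ω)
    {k : ℝ} {D₁ D₂ : Set Plane} {ρ₁ ρ₂ : Plane → ℂ} {a₁ a₂ : Fin 2 → ℂ} (hD₁ : IsOpen D₁)
    (hD₂ : IsOpen D₂) (hc₁ : closure D₁ ⊆ Ω) (hc₂ : closure D₂ ⊆ Ω) {u₁ u₂ : SobolevH1 Ω}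
    {c : BoundaryL2 Ω × (TraceSpace Ω → ℂ)}
    (h₁ : HasCauchyData k (dipoleSource D₁ ρ₁ a₁) u₁ c)
    (h₂ : HasCauchyData k (dipoleSource D₂ ρ₂ a₂) u₂ c) {ζ : Fin 2 → ℂ}
    (hζ : ζ 0 ^ 2 + ζ 1 ^ 2 = -(k : ℂ) ^ 2) :
    (∑ i, a₁ i * ζ i) * ∫ x in D₁, ρ₁ x * planeExp ζ x =
      (∑ i, a₂ i * ζ i) * ∫ x in D₂, ρ₂ x * planeExp ζ x := by
  have hd (i) : pderiv i (planeExp ζ) = fun x => ζ i * planeExp ζ x := by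
    funext x
    simpa using pderiv_const_mul_planeExp 1 ζ i x
  have key := integral_dipole_eq_of_cauchyData_eq hΩ hD₁ hD₂ hc₁ hc₂ h₁ h₂ (contDiff_planeExp ζ)
    (fun i => by rw [hd]; exact contDiff_const.mul (contDiff_planeExp ζ))
    (fun x => by
      simp only [hd, pderiv_const_mul_planeExp, Fin.sum_univ_two]
      linear_combination planeExp ζ x * hζ)
  have e (D : Set Plane) (ρ : Plane → ℂ) (a : Fin 2 → ℂ) :
      ∫ x in D, ρ x * ∑ i, a i * pderiv i (planeExp ζ) x =
        (∑ i, a i * ζ i) * ∫ x in D, ρ x * planeExp ζ x := by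
    rw [← integral_const_mul]
    refine integral_congr_ae (Eventually.of_forall fun x => ?_)
    simp only [hd, Fin.sum_univ_two]
    ring
  rwa [e, e] at key

/-! ### Convex hulls of polygons and their corners -/

/-- Two opposite rays from a point must leave the bounded set, and the point lies between the two
frontier points so found. -/
theorem IsOpen.subset_convexHull_frontier {D : Set Plane} (hD : IsOpen D)
    (hb : Bornology.IsBounded D) : D ⊆ convexHull ℝ (frontier D) := by
  intro x hx
  have hray (v : Plane) (hv : v ≠ 0) : ∃ t : ℝ, 0 ≤ t ∧ x + t • v ∈ frontier D := by
    by_contra! h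
    have hpre : IsPreconnected ((fun t : ℝ => x + t • v) '' Set.Ici 0) :=
      isPreconnected_Ici.image _ (by fun_prop)
    have hsub := hpre.subset_of_disjoint_frontier hD
      (Set.disjoint_left.2 (by rintro _ ⟨t, ht, rfl⟩; exact h t ht))
      ⟨x, ⟨0, by simp, by simp⟩, hx⟩
    obtain ⟨R, hR⟩ := hb.subset_closedBall x
    have hv' : 0 < ‖v‖ := norm_pos_iff.2 hv
    have ht : (0 : ℝ) ≤ (|R| + 1) / ‖v‖ := by positivity
    have := hR (hsub ⟨(|R| + 1) / ‖v‖, ht, rfl⟩)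
    rw [Metric.mem_closedBall, dist_self_add_left, norm_smul, Real.norm_of_nonneg ht,
      div_mul_cancel₀ _ hv'.ne'] at this
    linarith [le_abs_self R]
  have hv : EuclideanSpace.single (0 : Fin 2) (1 : ℝ) ≠ (0 : Plane) := by simp
  obtain ⟨t, ht, hy⟩ := hray _ hv
  obtain ⟨s, hs, hz⟩ := hray _ (neg_ne_zero.2 hv)
  refine (convex_convexHull ℝ _).segment_subset (subset_convexHull ℝ _ hz)
    (subset_convexHull ℝ _ hy) ?_
  rcases eq_or_lt_of_le (add_nonneg ht hs) with h0 | h0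
  · obtain rfl : t = 0 := by linarith
    obtain rfl : s = 0 := by linarith
    simp
  · refine ⟨t / (t + s), s / (t + s), by positivity, by positivity, by field_simp, ?_⟩
    set v : Plane := EuclideanSpace.single (0 : Fin 2) (1 : ℝ)
    have : (t / (t + s)) • (x + s • -v) + (s / (t + s)) • (x + t • v) =
        (t / (t + s) + s / (t + s)) • x + (s / (t + s) * t - t / (t + s) * s) • v := by
      module
    rw [this, ← add_div, div_self h0.ne', one_smul,
      show s / (t + s) * t - t / (t + s) * s = 0 by ring, zero_smul, add_zero]

theorem Polygon.vertex_mem_edgeSet {n : ℕ} {P : Polygon Plane n} (i : Fin n) :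
    P i ∈ P.edgeSet ℝ i :=
  left_mem_affineSegment ℝ _ _

theorem Polygon.boundary_subset_convexHull {n : ℕ} {P : Polygon Plane n} :
    P.boundary ℝ ⊆ convexHull ℝ (Set.range P) := by
  refine Set.iUnion_subset fun i => ?_
  rw [Polygon.edgeSet, affineSegment_eq_segment]
  exact (convex_convexHull ℝ _).segment_subset (subset_convexHull ℝ _ ⟨_, rfl⟩)
    (subset_convexHull ℝ _ ⟨_, rfl⟩)

section Polygon

variable {n : ℕ} [NeZero n] {P : Polygon Plane n} {D : Set Plane}

theorem IsPolygonInterior.subset_convexHull (h : IsPolygonInterior P D) :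
    D ⊆ convexHull ℝ (Set.range P) := by
  refine (h.isOpen.subset_convexHull_frontier h.isBounded).trans
    (convexHull_min ?_ (convex_convexHull ℝ _))
  rw [h.frontier_eq]
  exact Polygon.boundary_subset_convexHull

theorem IsPolygonInterior.vertex_mem_frontier (h : IsPolygonInterior P D) (i : Fin n) :
    P i ∈ frontier D := by
  rw [h.frontier_eq]
  exact Set.mem_iUnion.2 ⟨i, Polygon.vertex_mem_edgeSet i⟩

theorem IsPolygonInterior.closure_convexHull (h : IsPolygonInterior P D) :
    closure (convexHull ℝ D) = convexHull ℝ (Set.range P) := by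
  refine subset_antisymm (closure_minimal (convexHull_min h.subset_convexHull
    (convex_convexHull ℝ _)) ((Set.finite_range P).isClosed_convexHull ℝ))
    (convexHull_min ?_ (convex_convexHull ℝ D).closure)
  rintro _ ⟨i, rfl⟩
  exact closure_mono (_root_.subset_convexHull ℝ D)
    (frontier_subset_closure (h.vertex_mem_frontier i))

/-- The hull of an open set is open and convex, hence the interior of its closure. This reduces the
theorem to the closed hulls of the vertices. -/
theorem IsPolygonInterior.convexHull_eq (h : IsPolygonInterior P D) :
    convexHull ℝ D = interior (convexHull ℝ (Set.range P)) := by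
  have ho := h.isOpen.convexHull (𝕜 := ℝ)
  rw [← h.closure_convexHull,
    (convex_convexHull ℝ D).interior_closure_eq_interior_of_nonempty_interior,
    ho.interior_eq]
  rw [ho.interior_eq]
  exact h.isConnected.nonempty.mono (_root_.subset_convexHull ℝ D)

/-- Hahn–Banach separates `p` from the hull of the other points of `V`. The gap divided by a bound
for the distances to `p` gives `c` at the points of `V`, and the inequality passes to the hull by
convexity. The linear growth is what makes the exponentials decay away from `p`. -/
theorem exists_exposing_functional {V : Set Plane} (hV : V.Finite) {p : Plane}
    (hp : p ∈ (convexHull ℝ V).extremePoints ℝ) :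
    ∃ (f : Plane →L[ℝ] ℝ) (c : ℝ), 0 < c ∧ ∀ x ∈ convexHull ℝ V, c * ‖x - p‖ ≤ f (x - p) := by
  have hp' : p ∉ convexHull ℝ (V \ {p}) := fun h =>
    (((convex_convexHull ℝ V).mem_extremePoints_iff_mem_sdiff_convexHull_sdiff).1 hp).2
      (convexHull_mono (Set.sdiff_subset_sdiff_left (subset_convexHull ℝ V)) h)
  obtain ⟨f, u, hfp, hfu⟩ := geometric_hahn_banach_point_closed (convex_convexHull ℝ (V \ {p}))
    ((hV.subset Set.sdiff_subset).isClosed_convexHull ℝ) hp'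
  obtain ⟨R, hR⟩ := hV.isBounded.subset_closedBall p
  have hR' : 0 < |R| + 1 := by positivity
  refine ⟨f, (u - f p) / (|R| + 1), div_pos (by linarith) hR', ?_⟩
  have hconv : Convex ℝ {x : Plane | (u - f p) / (|R| + 1) * ‖x - p‖ ≤ f (x - p)} := by
    have h1 : ConvexOn ℝ Set.univ fun x : Plane =>
        (u - f p) / (|R| + 1) * ‖x - p‖ - f (x - p) := by
      refine ConvexOn.sub ?_ ?_
      · have h2 : ConvexOn ℝ Set.univ fun x : Plane => dist x p := convexOn_dist p convex_univ
        have := h2.smul (c := (u - f p) / (|R| + 1)) (by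
          have : 0 ≤ u - f p := by linarith
          positivity)
        simpa [dist_eq_norm] using this
      · have h3 := (f.toLinearMap.concaveOn (s := Set.univ) convex_univ).add_const (-(f p))
        refine h3.congr fun x _ => ?_
        simp [sub_eq_add_neg]
    have h4 := h1.convex_le 0
    simpa using h4
  refine fun x hx => convexHull_min (fun v hv => ?_) hconv hx
  change (u - f p) / (|R| + 1) * ‖v - p‖ ≤ f (v - p)
  by_cases hvp : v = p
  · simp [hvp]
  · have h1 := hfu v (subset_convexHull ℝ _ ⟨hv, hvp⟩)
    have h2 : ‖v - p‖ ≤ |R| + 1 := by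
      have := hR hv
      rw [Metric.mem_closedBall, dist_eq_norm] at this
      linarith [le_abs_self R]
    rw [map_sub, div_mul_eq_mul_div, div_le_iff₀ hR']
    nlinarith

/-- Simplicity separates only non-adjacent edges. Any third edge is non-adjacent to one of the two
edges at `P i`, except in a triangle, where it joins the two neighbours of `P i` and
non-collinearity excludes `P i`. -/
theorem IsSimplePolygon.notMem_edgeSet (h : IsSimplePolygon P) {i j k : Fin n}
    (hj : finRotate n j = i) (hcol : ¬ Collinear ℝ {P j, P i, P (finRotate n i)})
    (hki : k ≠ i) (hkj : k ≠ j) : P i ∉ P.edgeSet ℝ k := by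
  intro hmem
  have hik : i ≠ finRotate n k := fun e => hkj ((finRotate n).injective (e ▸ hj.symm))
  by_cases h1 : k = finRotate n i
  · by_cases h2 : j = finRotate n k
    · refine hcol ?_
      rw [Polygon.edgeSet, ← h2, h1] at hmem
      have h3 : Wbtw ℝ (P (finRotate n i)) (P i) (P j) := hmem
      exact h3.symm.collinear
    · have hd := h.2 j k hkj (by rw [hj]; exact hki) h2
      refine Set.disjoint_left.1 hd ?_ hmem
      rw [Polygon.edgeSet, hj]
      exact right_mem_affineSegment ℝ _ _
  · exact Set.disjoint_left.1 (h.2 i k hki h1 hik) (Polygon.vertex_mem_edgeSet i) hmem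

/-- The linear coordinates given by two vectors that are not collinear with the origin. -/
theorem exists_coordinates {p q r : Plane} (h : ¬ Collinear ℝ {q, p, r}) :
    ∃ A : (ℝ × ℝ) ≃L[ℝ] Plane, ∀ s, A s = s.1 • (r - p) + s.2 • (q - p) := by
  let A₀ : (ℝ × ℝ) →ₗ[ℝ] Plane :=
    (LinearMap.fst ℝ ℝ ℝ).smulRight (r - p) + (LinearMap.snd ℝ ℝ ℝ).smulRight (q - p)
  have hA₀ (s) : A₀ s = s.1 • (r - p) + s.2 • (q - p) := rfl
  have hinj : Function.Injective A₀ := by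
    rw [← LinearMap.ker_eq_bot, LinearMap.ker_eq_bot']
    rintro ⟨s, t⟩ hst
    rw [hA₀] at hst
    dsimp only at hst
    have hs : s = 0 := by
      by_contra hs
      refine h ((collinear_iff_of_mem (p₀ := p) (by simp)).2 ⟨q - p, ?_⟩)
      rintro x (rfl | rfl | rfl)
      · exact ⟨1, by simp⟩
      · exact ⟨0, by simp⟩
      · refine ⟨-(t / s), ?_⟩
        have h1 : x - p = (-(t / s)) • (q - p) := by
          have h2 : s • (x - p) = s • (-(t / s)) • (q - p) := by
            rw [smul_smul, show s * -(t / s) = -t by field_simp, neg_smul]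
            exact eq_neg_of_add_eq_zero_left hst
          exact smul_right_injective _ hs h2
        rw [← h1, vadd_eq_add, sub_add_cancel]
    subst hs
    have ht : t = 0 := by
      by_contra ht
      rw [zero_smul, zero_add, smul_eq_zero] at hst
      have hqp : q = p := sub_eq_zero.1 (hst.resolve_left ht)
      refine h ?_
      rw [hqp]
      simpa using collinear_pair ℝ p r
    rw [ht]
    rfl
  exact ⟨(LinearMap.linearEquivOfInjective A₀ hinj (by simp)).toContinuousLinearEquiv,
    fun s => hA₀ s⟩

/-- Near the vertex the frontier consists exactly of the two rays along its edges, so `D` fills or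
misses each of the two sectors they bound. The reflex sector contains points where `f (x - P i) <
0`, outside the hull, so it is missed; the convex one is filled because the vertex lies in the
closure of `D`. -/
theorem IsPolygonInterior.exists_corner (h : IsPolygonInterior P D) (i : Fin n)
    {f : Plane →L[ℝ] ℝ} {c : ℝ} (hc : 0 < c)
    (hf : ∀ x ∈ convexHull ℝ (Set.range P), c * ‖x - P i‖ ≤ f (x - P i)) :
    ∃ (A : (ℝ × ℝ) ≃L[ℝ] Plane) (r : ℝ), 0 < r ∧ 0 < f (A (1, 0)) ∧ 0 < f (A (0, 1)) ∧
      ∀ q, ‖A q‖ < r → (P i + A q ∈ D ↔ 0 < q.1 ∧ 0 < q.2) := by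
  obtain ⟨m, rfl⟩ := Nat.exists_eq_succ_of_ne_zero (NeZero.ne n)
  set j := (finRotate (m + 1)).symm i with hjdef
  have hj : finRotate (m + 1) j = i := by simp [hjdef]
  set p := P i with hp
  have hcol : ¬ Collinear ℝ {P j, p, P (finRotate (m + 1) i)} := by
    have h1 := h.isSimple.1 j
    rw [affineIndependent_iff_not_collinear_set] at h1
    have e1 : j + 1 = i := by rw [← finRotate_apply]; exact hj
    have e2 : j + 2 = finRotate (m + 1) i := by
      rw [finRotate_apply, ← e1, add_assoc]
      congr 1
      refine Fin.ext ?_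
      change 2 % (m + 1) = (1 % (m + 1) + 1 % (m + 1)) % (m + 1)
      rw [← Nat.add_mod]
    rwa [e1, e2] at h1
  obtain ⟨A, hA⟩ := exists_coordinates hcol
  set v := P (finRotate (m + 1) i) - p with hv
  set w := P j - p with hw
  have hA1 : A (1, 0) = v := by simp [hA]
  have hA2 : A (0, 1) = w := by simp [hA]
  have hv0 : 0 < ‖v‖ := by
    rw [← hA1, norm_pos_iff]
    exact fun h => by simpa using A.map_eq_zero_iff.1 h
  have hw0 : 0 < ‖w‖ := by
    rw [← hA2, norm_pos_iff]
    exact fun h => by simpa using A.map_eq_zero_iff.1 h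
  have hfv : 0 < f v :=
    (mul_pos hc hv0).trans_le (hf _ (_root_.subset_convexHull ℝ _ ⟨_, rfl⟩))
  have hfw : 0 < f w :=
    (mul_pos hc hw0).trans_le (hf _ (_root_.subset_convexHull ℝ _ ⟨_, rfl⟩))
  set T : Set Plane := ⋃ k ∈ {k | k ≠ i ∧ k ≠ j}, P.edgeSet ℝ k with hT
  have hTc : IsClosed T := (Set.toFinite _).isClosed_biUnion fun k _ => by
    rw [Polygon.edgeSet, affineSegment_eq_segment, ← convexHull_pair]
    exact (Set.toFinite _).isClosed_convexHull ℝ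
  have hpT : p ∉ T := by
    intro hmem
    obtain ⟨k, hk, hk'⟩ := Set.mem_iUnion₂.1 hmem
    exact h.isSimple.notMem_edgeSet hj hcol hk.1 hk.2 hk'
  obtain ⟨r₀, hr₀, hr₀T⟩ := Metric.isOpen_iff.1 hTc.isOpen_compl p hpT
  -- Within `r₀` there are no other edges; below `‖v‖` and `‖w‖` the rays have not yet left the two
  -- edges.
  set r := min r₀ (min ‖v‖ ‖w‖) with hr
  have hr0 : 0 < r := lt_min hr₀ (lt_min hv0 hw0)
  have hrv : r ≤ ‖v‖ := (min_le_right _ _).trans (min_le_left _ _)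
  have hrw : r ≤ ‖w‖ := (min_le_right _ _).trans (min_le_right _ _)
  have hfr (q) (hq : ‖A q‖ < r) (hqD : p + A q ∈ frontier D) :
      (0 ≤ q.1 ∧ q.2 = 0) ∨ (q.1 = 0 ∧ 0 ≤ q.2) := by
    rw [h.frontier_eq] at hqD
    obtain ⟨k, hk⟩ := Set.mem_iUnion.1 hqD
    by_cases hki : k = i
    · subst hki
      obtain ⟨θ, hθ, hθq⟩ := hk
      have : A (θ, 0) = A q := by
        rw [hA]
        rw [AffineMap.lineMap_apply_module', add_comm, add_right_inj] at hθq
        rw [← hθq, zero_smul, add_zero]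
      obtain rfl := A.injective this
      exact Or.inl ⟨hθ.1, rfl⟩
    by_cases hkj : k = j
    · subst hkj
      obtain ⟨θ, hθ, hθq⟩ := hk
      have : A (0, 1 - θ) = A q := by
        rw [hA]
        rw [hj, AffineMap.lineMap_apply_module] at hθq
        rw [← add_right_inj p, ← hθq]
        simp only [hw]
        module
      obtain rfl := A.injective this
      exact Or.inr ⟨rfl, by simpa using hθ.2⟩
    · refine absurd (Set.mem_biUnion (show k ∈ {k | k ≠ i ∧ k ≠ j} from ⟨hki, hkj⟩) hk)
        (hr₀T ?_)
      rw [Metric.mem_ball, dist_self_add_left]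
      exact hq.trans_le (min_le_left _ _)
  have hfr' (q) (hq : ‖A q‖ < r) (hq' : (0 ≤ q.1 ∧ q.2 = 0) ∨ (q.1 = 0 ∧ 0 ≤ q.2)) :
      p + A q ∈ frontier D := by
    rw [h.frontier_eq]
    obtain ⟨s, t⟩ := q
    rcases hq' with ⟨h1, h2⟩ | ⟨h1, h2⟩
    · dsimp only at h1 h2
      subst h2
      refine Set.mem_iUnion.2 ⟨i, s, ⟨h1, ?_⟩, ?_⟩
      · rw [hA, zero_smul, add_zero, norm_smul, Real.norm_of_nonneg h1] at hq
        by_contra! hs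
        nlinarith
      · rw [AffineMap.lineMap_apply_module', hA, zero_smul, add_zero, add_comm]
    · dsimp only at h1 h2
      subst h1
      refine Set.mem_iUnion.2 ⟨j, 1 - t, ⟨?_, by linarith⟩, ?_⟩
      · rw [hA, zero_smul, zero_add, norm_smul, Real.norm_of_nonneg h2] at hq
        by_contra! hs
        nlinarith
      · rw [hj, AffineMap.lineMap_apply_module, hA]
        simp only [hw, ← hp]
        module
  have hball : Convex ℝ {q : ℝ × ℝ | ‖A q‖ < r} := by
    have h1 : {q : ℝ × ℝ | ‖A q‖ < r} = A.toLinearEquiv.toLinearMap ⁻¹' Metric.ball 0 r := by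
      ext q
      simp
    rw [h1]
    exact (convex_ball (0 : Plane) r).linear_preimage _
  have hmap (S : Set (ℝ × ℝ)) (hS : Convex ℝ S) :
      IsPreconnected ((fun q => p + A q) '' (S ∩ {q | ‖A q‖ < r})) :=
    (hS.inter hball).isPreconnected.image _ (by fun_prop)
  have hcomp (S : Set (ℝ × ℝ)) (hS : Convex ℝ S)
      (hSf : ∀ q ∈ S, ¬ ((0 ≤ q.1 ∧ q.2 = 0) ∨ (q.1 = 0 ∧ 0 ≤ q.2))) {q₀ : ℝ × ℝ} (hq₀ : q₀ ∈ S)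
      (hq₀r : ‖A q₀‖ < r) (hq₀D : p + A q₀ ∈ D) {q : ℝ × ℝ} (hq : q ∈ S) (hqr : ‖A q‖ < r) :
      p + A q ∈ D := by
    refine (hmap S hS).subset_of_disjoint_frontier h.isOpen ?_ ⟨_, ⟨q₀, ⟨hq₀, hq₀r⟩, rfl⟩, hq₀D⟩
      ⟨q, ⟨hq, hqr⟩, rfl⟩
    refine Set.disjoint_left.2 ?_
    rintro _ ⟨q', ⟨h1, h2⟩, rfl⟩ h3
    exact hSf q' h1 (hfr q' h2 h3)
  -- This point lies in both half-planes `q.1 < 0` and `q.2 < 0`. Each avoids the two rays, and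
  -- together they make up the reflex sector.
  obtain ⟨ε, hε, hεr⟩ : ∃ ε : ℝ, 0 < ε ∧ ‖A (-ε, -ε)‖ < r := by
    have hcont : Tendsto (fun ε : ℝ => ‖A (-ε, -ε)‖) (𝓝[>] 0) (𝓝 0) := by
      have : Continuous fun ε : ℝ => ‖A (-ε, -ε)‖ := by fun_prop
      have h1 := this.continuousWithinAt (s := Set.Ioi 0) (x := 0) |>.tendsto
      simpa [hA] using h1
    obtain ⟨ε, h1, h2⟩ := ((hcont.eventually_lt_const hr0).and self_mem_nhdsWithin).exists
    exact ⟨ε, h2, h1⟩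
  have hout : p + A (-ε, -ε) ∉ D := by
    intro hmem
    have h1 := hf _ (h.subset_convexHull hmem)
    rw [add_sub_cancel_left, hA, map_add, map_smul, map_smul, smul_eq_mul, smul_eq_mul] at h1
    have h2 : 0 ≤ c * ‖(-ε) • v + (-ε) • w‖ := by positivity
    nlinarith [mul_pos hε hfv, mul_pos hε hfw]
  have hpos (q) (hq : ‖A q‖ < r) (hqD : p + A q ∈ D) : 0 < q.1 ∧ 0 < q.2 := by
    have hnf : p + A q ∉ frontier D := fun hmem => by
      rw [h.isOpen.frontier_eq] at hmem
      exact hmem.2 hqD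
    have h1 : ¬ q.1 < 0 := fun h1 => hout (hcomp {q | q.1 < 0}
      (convex_halfSpace_lt (LinearMap.fst ℝ ℝ ℝ).isLinear 0)
      (fun q' (hq' : q'.1 < 0) => by rintro (⟨h2, -⟩ | ⟨h2, -⟩) <;> linarith) h1 hq hqD
      (show (-ε, -ε) ∈ {q : ℝ × ℝ | q.1 < 0} by simpa using hε) hεr)
    have h2 : ¬ q.2 < 0 := fun h1 => hout (hcomp {q | q.2 < 0}
      (convex_halfSpace_lt (LinearMap.snd ℝ ℝ ℝ).isLinear 0)
      (fun q' (hq' : q'.2 < 0) => by rintro (⟨-, h2⟩ | ⟨-, h2⟩) <;> linarith) h1 hq hqD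
      (show (-ε, -ε) ∈ {q : ℝ × ℝ | q.2 < 0} by simpa using hε) hεr)
    rw [not_lt] at h1 h2
    refine ⟨h1.lt_of_ne fun e => hnf (hfr' q hq (Or.inr ⟨e.symm, h2⟩)),
      h2.lt_of_ne fun e => hnf (hfr' q hq (Or.inl ⟨h1, e.symm⟩))⟩
  refine ⟨A, r, hr0, hA1 ▸ hfv, hA2 ▸ hfw, fun q hq => ⟨hpos q hq, fun hq' => ?_⟩⟩
  obtain ⟨x, hxD, hx⟩ := Metric.mem_closure_iff.1
    (frontier_subset_closure (h.vertex_mem_frontier i)) r hr0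
  have hxA : p + A (A.symm (x - p)) = x := by simp
  have hxr : ‖A (A.symm (x - p))‖ < r := by
    rw [A.apply_symm_apply, ← dist_eq_norm, dist_comm]
    exact hx
  exact hcomp {q | 0 < q.1 ∧ 0 < q.2}
    ((convex_halfSpace_gt (LinearMap.fst ℝ ℝ ℝ).isLinear 0).inter
      (convex_halfSpace_gt (LinearMap.snd ℝ ℝ ℝ).isLinear 0))
    (fun q' hq' => by
      rintro (⟨-, h2⟩ | ⟨h2, -⟩)
      · exact hq'.2.ne' h2
      · exact hq'.1.ne' h2)
    (hpos _ hxr (hxA.symm ▸ hxD)) hxr (hxA.symm ▸ hxD) hq' hq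

end Polygon

/-! ### Asymptotics of exponential integrals at a corner -/

/-- Uniqueness of Haar measure; only `κ ≠ 0` matters, so the Jacobian is not computed. -/
theorem exists_integral_eq_smul_integral_comp (A : (ℝ × ℝ) ≃L[ℝ] Plane) :
    ∃ κ : ℝ, κ ≠ 0 ∧ ∀ g : Plane → ℂ, ∫ x, g x = κ • ∫ q, g (A q) := by
  have := A.isAddHaarMeasure_map (volume : Measure (ℝ × ℝ))
  have h := Measure.isAddLeftInvariant_eq_smul
    (Measure.map A (volume : Measure (ℝ × ℝ))) (volume : Measure Plane)
  have hc := Measure.addHaarScalarFactor_pos_of_isAddHaarMeasure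
    (Measure.map A (volume : Measure (ℝ × ℝ))) (volume : Measure Plane)
  set c := Measure.addHaarScalarFactor
    (Measure.map A (volume : Measure (ℝ × ℝ))) (volume : Measure Plane)
  refine ⟨c⁻¹, by exact_mod_cast (inv_pos.2 hc).ne', fun g => ?_⟩
  have e : ∫ y, g y ∂(Measure.map A volume) = ∫ q, g (A q) :=
    A.toHomeomorph.measurableEmbedding.integral_map g
  rw [← e, h, integral_smul_nnreal_measure]
  exact (inv_smul_smul₀ hc.ne' _).symm

theorem norm_planeExp (ζ : Fin 2 → ℂ) (x : Plane) :
    ‖planeExp ζ x‖ = Real.exp (∑ i, ζ i * x i).re := Complex.norm_exp _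

theorem planeExp_add (ζ : Fin 2 → ℂ) (x y : Plane) :
    planeExp ζ (x + y) = planeExp ζ x * planeExp ζ y := by
  rw [planeExp, planeExp, planeExp, ← Complex.exp_add]
  congr 1
  simp only [Fin.sum_univ_two, PiLp.add_apply, Complex.ofReal_add]
  ring

/-- On `D` the exponential has modulus at most `exp (-δ τ)`, which beats `τ²`. -/
theorem tendsto_sq_mul_integral_planeExp_zero {D : Set Plane} (hD : MeasurableSet D)
    {ρ : Plane → ℂ} (hρ : IntegrableOn ρ D) {p : Plane} {f : Plane →L[ℝ] ℝ} {δ : ℝ} (hδ : 0 < δ)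
    (hf : ∀ x ∈ D, δ ≤ f (x - p)) {ζ : ℝ → Fin 2 → ℂ}
    (hζ : ∀ τ (x : Plane), (∑ i, ζ τ i * x i).re = -(τ * f x)) :
    Tendsto (fun τ : ℝ => (τ : ℂ) ^ 2 * ∫ x in D, ρ x * planeExp (ζ τ) (x - p)) atTop (𝓝 0) := by
  have hlim := (tendsto_rpow_mul_exp_neg_mul_atTop_nhds_zero 2 δ hδ).mul_const (∫ x in D, ‖ρ x‖)
  rw [zero_mul] at hlim
  refine squeeze_zero_norm' ?_ hlim
  filter_upwards [eventually_ge_atTop 0] with τ hτ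
  rw [norm_mul, norm_pow, Complex.norm_real, Real.norm_of_nonneg hτ, mul_assoc]
  norm_cast
  refine mul_le_mul_of_nonneg_left ?_ (by positivity)
  rw [← integral_const_mul]
  refine norm_integral_le_of_norm_le (hρ.norm.const_mul _) ?_
  refine ae_restrict_of_forall_mem hD fun x hx => ?_
  rw [norm_mul, norm_planeExp, hζ, mul_comm]
  refine mul_le_mul_of_nonneg_right (Real.exp_le_exp.2 ?_) (norm_nonneg _)
  nlinarith [hf x hx]

theorem integrableOn_quadrant_exp {b₁ b₂ : ℂ} (h₁ : b₁.re < 0) (h₂ : b₂.re < 0) :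
    IntegrableOn (fun q : ℝ × ℝ => Complex.exp (b₁ * q.1) * Complex.exp (b₂ * q.2))
      (Set.Ioi 0 ×ˢ Set.Ioi 0) := by
  rw [IntegrableOn, Measure.volume_eq_prod, ← Measure.prod_restrict]
  exact (integrableOn_exp_mul_complex_Ioi h₁ 0).mul_prod (integrableOn_exp_mul_complex_Ioi h₂ 0)

theorem integral_quadrant_exp {b₁ b₂ : ℂ} (h₁ : b₁.re < 0) (h₂ : b₂.re < 0) :
    ∫ q in (Set.Ioi 0 ×ˢ Set.Ioi 0 : Set (ℝ × ℝ)),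
      Complex.exp (b₁ * q.1) * Complex.exp (b₂ * q.2) = 1 / (b₁ * b₂) := by
  have h := setIntegral_prod_mul (μ := (volume : Measure ℝ)) (ν := (volume : Measure ℝ))
    (fun s : ℝ => Complex.exp (b₁ * s)) (fun s : ℝ => Complex.exp (b₂ * s)) (Set.Ioi 0) (Set.Ioi 0)
  rw [Measure.volume_eq_prod, h, integral_exp_mul_complex_Ioi h₁, integral_exp_mul_complex_Ioi h₂]
  have hb₁ : b₁ ≠ 0 := fun h => by simp [h] at h₁
  have hb₂ : b₂ ≠ 0 := fun h => by simp [h] at h₂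
  simp
  field_simp

/-- The substitution `x = p + A (y / τ)` has an area factor `τ⁻²` that cancels `τ²`. The density
freezes at `ρ p`, the domain grows to the whole quadrant, and the limiting exponential factorizes
there. -/
theorem tendsto_sq_mul_integral_corner {ρ : Plane → ℂ} {p : Plane} {r M : ℝ} (hr : 0 < r)
    (hρ : ContinuousOn ρ (Metric.ball p r)) (hM : ∀ x ∈ Metric.ball p r, ‖ρ x‖ ≤ M)
    (A : (ℝ × ℝ) ≃L[ℝ] Plane) {f : Plane →L[ℝ] ℝ} (hf₁ : 0 < f (A (1, 0)))
    (hf₂ : 0 < f (A (0, 1))) {D : Set Plane} (hD : MeasurableSet D)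
    (hDA : ∀ q, ‖A q‖ < r → (p + A q ∈ D ↔ 0 < q.1 ∧ 0 < q.2)) {ζ : ℝ → Fin 2 → ℂ}
    (hζ : ∀ τ (x : Plane), (∑ i, ζ τ i * x i).re = -(τ * f x)) {ξ : Fin 2 → ℂ}
    (hξ : ∀ x : Plane, (∑ i, ξ i * x i).re = -f x)
    (hlim : ∀ i, Tendsto (fun τ : ℝ => ζ τ i / τ) atTop (𝓝 (ξ i))) :
    ∃ κ : ℝ, κ ≠ 0 ∧
    Tendsto (fun τ : ℝ => (τ : ℂ) ^ 2 * ∫ x in D ∩ Metric.ball p r, ρ x * planeExp (ζ τ) (x - p))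
      atTop (𝓝 (κ * (ρ p * (1 / ((∑ i, ξ i * (A (1, 0)) i) * ∑ i, ξ i * (A (0, 1)) i))))) := by
  obtain ⟨κ, hκ, hκi⟩ := exists_integral_eq_smul_integral_comp A
  refine ⟨κ, hκ, ?_⟩
  set b₁ : ℂ := ∑ i, ξ i * (A (1, 0)) i with hb₁
  set b₂ : ℂ := ∑ i, ξ i * (A (0, 1)) i with hb₂
  have hb₁' : b₁.re < 0 := by rw [hb₁, hξ]; linarith
  have hb₂' : b₂.re < 0 := by rw [hb₂, hξ]; linarith
  have hAq (q : ℝ × ℝ) : A q = q.1 • A (1, 0) + q.2 • A (0, 1) := by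
    rw [← map_smul, ← map_smul, ← map_add]
    simp
  set Q : Set (ℝ × ℝ) := Set.Ioi 0 ×ˢ Set.Ioi 0 with hQ
  set S : ℝ → Set (ℝ × ℝ) := fun τ => Q ∩ {y | ‖A (τ⁻¹ • y)‖ < r} with hS
  have hSo (τ) : IsOpen (S τ) :=
    (isOpen_Ioi.prod isOpen_Ioi).inter (isOpen_lt (by fun_prop) continuous_const)
  have hSb {τ y} (hy : y ∈ S τ) : p + A (τ⁻¹ • y) ∈ Metric.ball p r := by
    rw [Metric.mem_ball, dist_self_add_left]
    exact hy.2
  set F : ℝ → ℝ × ℝ → ℂ := fun τ => (S τ).indicator fun y =>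
    ρ (p + A (τ⁻¹ • y)) * planeExp (ζ τ) (A (τ⁻¹ • y)) with hF
  have hF1 {τ y} (hy : y ∈ S τ) :
      F τ y = ρ (p + A (τ⁻¹ • y)) * planeExp (ζ τ) (A (τ⁻¹ • y)) := Set.indicator_of_mem hy _
  have hF0 {τ y} (hy : y ∉ S τ) : F τ y = 0 := Set.indicator_of_notMem hy _
  have hint : ∀ᶠ τ : ℝ in atTop, (τ : ℂ) ^ 2 * ∫ x in D ∩ Metric.ball p r,
      ρ x * planeExp (ζ τ) (x - p) = κ * ∫ y, F τ y := by
    filter_upwards [eventually_gt_atTop 0] with τ hτ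
    rw [← integral_indicator (hD.inter Metric.isOpen_ball.measurableSet),
      ← integral_add_left_eq_self _ p, hκi]
    have h1 := Measure.integral_comp_smul (volume : Measure (ℝ × ℝ)) (fun q =>
      (D ∩ Metric.ball p r).indicator (fun x => ρ x * planeExp (ζ τ) (x - p)) (p + A q)) τ⁻¹
    have h2 : ∀ y, (D ∩ Metric.ball p r).indicator (fun x => ρ x * planeExp (ζ τ) (x - p))
        (p + A (τ⁻¹ • y)) = F τ y := by
      intro y
      have h3 : p + A (τ⁻¹ • y) ∈ D ∩ Metric.ball p r ↔ y ∈ S τ := by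
        have h4 : p + A (τ⁻¹ • y) ∈ Metric.ball p r ↔ ‖A (τ⁻¹ • y)‖ < r := by
          rw [Metric.mem_ball, dist_self_add_left]
        rw [Set.mem_inter_iff, h4]
        refine ⟨fun h => ⟨?_, h.2⟩, fun h => ⟨(hDA _ h.2).2 ?_, h.2⟩⟩
        · have h5 := (hDA _ h.2).1 h.1
          simpa [hτ, hQ] using h5
        · have h5 : 0 < y.1 ∧ 0 < y.2 := h.1
          simpa [hτ] using h5
      by_cases hy : y ∈ S τ
      · rw [hF1 hy, Set.indicator_of_mem (h3.2 hy), add_sub_cancel_left]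
      · rw [hF0 hy, Set.indicator_of_notMem (fun h => hy (h3.1 h))]
    simp only [h2] at h1
    rw [h1]
    have h6 : |((τ⁻¹ ^ Module.finrank ℝ (ℝ × ℝ))⁻¹ : ℝ)| = τ ^ 2 := by
      simp
    rw [h6]
    simp only [Complex.real_smul]
    push_cast
    ring
  have hexp (τ : ℝ) (y : ℝ × ℝ) : planeExp (ζ τ) (A (τ⁻¹ • y)) =
      Complex.exp (y.1 * (∑ i, ζ τ i / τ * (A (1, 0)) i) +
        y.2 * ∑ i, ζ τ i / τ * (A (0, 1)) i) := by
    rw [planeExp, hAq]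
    congr 1
    simp only [Fin.sum_univ_two, PiLp.add_apply, PiLp.smul_apply, smul_eq_mul, Prod.smul_fst,
      Prod.smul_snd, Complex.ofReal_add, Complex.ofReal_mul, Complex.ofReal_inv]
    ring
  have hmain : Tendsto (fun τ => ∫ y, F τ y) atTop
      (𝓝 (∫ y, Q.indicator (fun y : ℝ × ℝ =>
        ρ p * (Complex.exp (b₁ * y.1) * Complex.exp (b₂ * y.2))) y)) := by
    refine tendsto_integral_filter_of_dominated_convergence (fun y => Q.indicator (fun y : ℝ × ℝ =>
      M * ‖Complex.exp (b₁ * y.1) * Complex.exp (b₂ * y.2)‖) y) ?_ ?_ ?_ ?_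
    · refine Eventually.of_forall fun τ => ?_
      refine (aestronglyMeasurable_indicator_iff (hSo τ).measurableSet).2
        (ContinuousOn.aestronglyMeasurable (ContinuousOn.mul ?_ ?_) (hSo τ).measurableSet)
      · exact hρ.comp (by fun_prop) fun y hy => hSb hy
      · exact ((contDiff_planeExp _).continuous.comp (by fun_prop)).continuousOn
    · filter_upwards [eventually_gt_atTop 0] with τ hτ
      refine Eventually.of_forall fun y => ?_
      by_cases hy : y ∈ S τ
      · rw [hF1 hy, Set.indicator_of_mem hy.1, norm_mul]
        refine mul_le_mul (hM _ (hSb hy)) (le_of_eq ?_) (norm_nonneg _)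
          ((norm_nonneg _).trans (hM _ (hSb hy)))
        -- Because `Re ζ τ = -τ f` exactly, the modulus of the rescaled exponential does not depend
        -- on `τ` and serves as the dominating function.
        rw [norm_planeExp, hζ, ← Complex.exp_add, Complex.norm_exp]
        congr 1
        rw [Complex.add_re, mul_comm b₁, mul_comm b₂, Complex.re_ofReal_mul, Complex.re_ofReal_mul,
          hb₁, hb₂, hξ, hξ, map_smul, map_smul, hAq, map_add, map_smul, map_smul]
        simp only [smul_eq_mul]
        field_simp
        ring
      · rw [hF0 hy, norm_zero]
        refine Set.indicator_nonneg (fun y _ => mul_nonneg ?_ (norm_nonneg _)) y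
        exact (norm_nonneg _).trans (hM p (Metric.mem_ball_self hr))
    · exact (integrable_indicator_iff (measurableSet_Ioi.prod measurableSet_Ioi)).2
        ((integrableOn_quadrant_exp hb₁' hb₂').norm.const_mul M)
    · refine Eventually.of_forall fun y => ?_
      by_cases hy : y ∈ Q
      · rw [Set.indicator_of_mem hy]
        have hA0 : Tendsto (fun τ : ℝ => A (τ⁻¹ • y)) atTop (𝓝 0) := by
          have h1 : Tendsto (fun τ : ℝ => τ⁻¹ • y) atTop (𝓝 0) := by
            simpa using (tendsto_inv_atTop_zero (𝕜 := ℝ)).smul_const y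
          have h2 := (A.continuous.tendsto 0).comp h1
          rwa [map_zero] at h2
        have hev : ∀ᶠ τ : ℝ in atTop, y ∈ S τ := by
          filter_upwards [hA0.norm.eventually_lt_const (by simpa using hr)] with τ hτ
          exact ⟨hy, hτ⟩
        have h1 : Tendsto (fun τ : ℝ => ρ (p + A (τ⁻¹ • y))) atTop (𝓝 (ρ p)) := by
          have h2 := hρ.continuousAt (Metric.ball_mem_nhds p hr)
          have h3 : Tendsto (fun τ : ℝ => p + A (τ⁻¹ • y)) atTop (𝓝 p) := by
            simpa using hA0.const_add p
          exact h2.tendsto.comp h3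
        have h2 : Tendsto (fun τ : ℝ => planeExp (ζ τ) (A (τ⁻¹ • y))) atTop
            (𝓝 (Complex.exp (b₁ * y.1) * Complex.exp (b₂ * y.2))) := by
          rw [← Complex.exp_add, mul_comm b₁, mul_comm b₂]
          simp only [hexp]
          refine (Complex.continuous_exp.tendsto _).comp (Tendsto.add ?_ ?_)
          · exact (tendsto_finsetSum _ fun i _ => (hlim i).mul_const _).const_mul _
          · exact (tendsto_finsetSum _ fun i _ => (hlim i).mul_const _).const_mul _
        refine (h1.mul h2).congr' ?_
        filter_upwards [hev] with τ hτ
        rw [hF1 hτ]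
      · rw [Set.indicator_of_notMem hy]
        refine tendsto_const_nhds.congr fun τ => ?_
        rw [hF0 fun h => hy h.1]
  rw [integral_indicator (measurableSet_Ioi.prod measurableSet_Ioi), integral_const_mul,
    integral_quadrant_exp hb₁' hb₂'] at hmain
  exact (hmain.const_mul (κ : ℂ)).congr' (hint.mono fun τ h => h.symm)

/-! ### Complex frequencies concentrating at a corner -/

/-- With `f = (α, β)`, the choice is `ζ = -τ (α, β) + i ε σ (-β, α)`, where `ε = ±1` and `σ ~ τ`.
Its real and imaginary parts are orthogonal, so `ζ · ζ = (τ² - σ²)(α² + β²)`. -/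
theorem exists_frequencies (f : Plane →L[ℝ] ℝ) (hf : f ≠ 0) (k : ℝ) {a : Fin 2 → ℂ} (ha : a ≠ 0) :
    ∃ (ζ : ℝ → Fin 2 → ℂ) (ξ : Fin 2 → ℂ),
      (∀ τ, ζ τ 0 ^ 2 + ζ τ 1 ^ 2 = -(k : ℂ) ^ 2) ∧
      (∀ τ (x : Plane), (∑ i, ζ τ i * x i).re = -(τ * f x)) ∧
      (∀ x : Plane, (∑ i, ξ i * x i).re = -f x) ∧
      (∀ i, Tendsto (fun τ : ℝ => ζ τ i / τ) atTop (𝓝 (ξ i))) ∧ ∑ i, a i * ξ i ≠ 0 := by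
  set α : ℝ := f (EuclideanSpace.single 0 1)
  set β : ℝ := f (EuclideanSpace.single 1 1)
  have hfx (x : Plane) : f x = α * x 0 + β * x 1 := by
    have hx : x = x 0 • EuclideanSpace.single 0 (1 : ℝ) + x 1 • EuclideanSpace.single 1 1 := by
      ext i
      fin_cases i <;> simp
    conv_lhs => rw [hx]
    rw [map_add, map_smul, map_smul, smul_eq_mul, smul_eq_mul, mul_comm, mul_comm (x 1)]
  have hN : 0 < α ^ 2 + β ^ 2 := by
    by_contra! h
    refine hf (ContinuousLinearMap.ext fun x => ?_)
    have h1 : α = 0 := by nlinarith [sq_nonneg α, sq_nonneg β]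
    have h2 : β = 0 := by nlinarith [sq_nonneg α, sq_nonneg β]
    rw [hfx, h1, h2]
    simp
  -- If both signs failed, `a` would be annihilated by the orthogonal vectors `(α, β)` and `(-β,
  -- α)`, hence zero.
  obtain ⟨ε, hε, hεa⟩ : ∃ ε : ℝ, ε ^ 2 = 1 ∧
      a 0 * (-α - ε * Complex.I * β) + a 1 * (-β + ε * Complex.I * α) ≠ 0 := by
    by_contra! h
    have h1 := h 1 (by norm_num)
    have h2 := h (-1) (by norm_num)
    push_cast at h1 h2
    have hN' : ((α : ℂ) ^ 2 + (β : ℂ) ^ 2) ≠ 0 := by exact_mod_cast hN.ne'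
    have e1 : a 0 * α + a 1 * β = 0 := by linear_combination (-1 / 2 : ℂ) * h1 - 1 / 2 * h2
    have e2 : Complex.I * (a 1 * α - a 0 * β) = 0 := by
      linear_combination (1 / 2 : ℂ) * h1 - 1 / 2 * h2
    have e3 : a 1 * α - a 0 * β = 0 := (mul_eq_zero.1 e2).resolve_left Complex.I_ne_zero
    refine ha (funext fun i => ?_)
    fin_cases i
    · refine (mul_eq_zero.1 (?_ : a 0 * ((α : ℂ) ^ 2 + (β : ℂ) ^ 2) = 0)).resolve_right hN'
      linear_combination (α : ℂ) * e1 - β * e3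
    · refine (mul_eq_zero.1 (?_ : a 1 * ((α : ℂ) ^ 2 + (β : ℂ) ^ 2) = 0)).resolve_right hN'
      linear_combination (β : ℂ) * e1 + α * e3
  -- Chosen so that `σ² = τ² + m` gives `ζ · ζ = -k²`.
  set m : ℝ := k ^ 2 / (α ^ 2 + β ^ 2) with hm
  have hm0 : 0 ≤ m := by positivity
  set σ : ℝ → ℝ := fun τ => √(τ ^ 2 + m) with hσ
  have hσ2 (τ) : σ τ ^ 2 = τ ^ 2 + m := Real.sq_sqrt (by positivity)
  have hσlim : Tendsto (fun τ => σ τ / τ) atTop (𝓝 1) := by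
    have h1 : Tendsto (fun τ : ℝ => √(1 + m * (τ⁻¹) ^ 2)) atTop (𝓝 1) := by
      have h2 := (((tendsto_inv_atTop_zero (𝕜 := ℝ)).pow 2).const_mul m).const_add 1
      have h3 := (Real.continuous_sqrt.tendsto _).comp h2
      simpa [Function.comp_def] using h3
    refine h1.congr' ?_
    filter_upwards [eventually_gt_atTop 0] with τ hτ
    rw [eq_div_iff hτ.ne', ← Real.sqrt_sq hτ.le, ← Real.sqrt_mul (by positivity),
      Real.sqrt_sq hτ.le]
    congr 1
    field_simp
  have hσlim' : Tendsto (fun τ => ((σ τ / τ : ℝ) : ℂ)) atTop (𝓝 1) := by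
    have := (Complex.continuous_ofReal.tendsto 1).comp hσlim
    simpa [Function.comp_def] using this
  refine ⟨fun τ => ![-τ * α - ε * Complex.I * σ τ * β, -τ * β + ε * Complex.I * σ τ * α],
    ![-α - ε * Complex.I * β, -β + ε * Complex.I * α], fun τ => ?_, fun τ x => ?_, fun x => ?_,
    fun i => ?_, ?_⟩
  · have h1 : ((σ τ : ℝ) : ℂ) ^ 2 = τ ^ 2 + m := by exact_mod_cast hσ2 τ
    have h2 : (m : ℂ) * (α ^ 2 + β ^ 2) = k ^ 2 := by
      rw [hm]
      exact_mod_cast div_mul_cancel₀ _ hN.ne'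
    have h3 : (ε : ℂ) ^ 2 = 1 := by exact_mod_cast hε
    simp only [Matrix.cons_val_zero, Matrix.cons_val_one]
    linear_combination (ε ^ 2 * (σ τ : ℂ) ^ 2 * (α ^ 2 + β ^ 2)) * Complex.I_sq
      - (σ τ : ℂ) ^ 2 * (α ^ 2 + β ^ 2) * h3 - (α ^ 2 + β ^ 2 : ℂ) * h1 - h2
  · rw [hfx]
    simp [Fin.sum_univ_two]
    ring
  · rw [hfx]
    simp [Fin.sum_univ_two]
    ring
  · have key (u v : ℂ) : Tendsto (fun τ : ℝ => u + ((σ τ / τ : ℝ) : ℂ) * v) atTop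
        (𝓝 (u + v)) := by
      simpa using (hσlim'.mul_const v).const_add u
    fin_cases i
    · refine ((key (-α) (-ε * Complex.I * β)).congr' ?_).trans_eq ?_
      · filter_upwards [eventually_gt_atTop 0] with τ hτ
        have : (τ : ℂ) ≠ 0 := by exact_mod_cast hτ.ne'
        simp only [Fin.zero_eta, Matrix.cons_val_zero]
        push_cast
        field_simp
        ring
      · congr 1
        simp only [Fin.zero_eta, Matrix.cons_val_zero]
        ring
    · refine ((key (-β) (ε * Complex.I * α)).congr' ?_).trans_eq ?_
      · filter_upwards [eventually_gt_atTop 0] with τ hτ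
        have : (τ : ℂ) ≠ 0 := by exact_mod_cast hτ.ne'
        simp only [Fin.mk_one, Matrix.cons_val_one]
        push_cast
        field_simp
      · congr 1
  · simpa [Fin.sum_univ_two] using hεa

/-! ### The convex hull is determined by the Cauchy data -/

theorem IsPolygonInterior.integrableOn {n : ℕ} [NeZero n] {P : Polygon Plane n} {D : Set Plane}
    (h : IsPolygonInterior P D) {ρ : Plane → ℂ} (hρ : MemLp ρ 2 (volume.restrict D)) :
    IntegrableOn ρ D := by
  have : IsFiniteMeasure (volume.restrict D) :=
    ⟨by rw [Measure.restrict_apply_univ]; exact h.isBounded.measure_lt_top⟩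
  exact hρ.integrable (by norm_num)

theorem mem_convexHull_of_mem_extremePoints {Ω : Opens Plane} {k : ℝ} {n₁ n₂ : ℕ} [NeZero n₁]
    [NeZero n₂] {P₁ : Polygon Plane n₁} {P₂ : Polygon Plane n₂} {D₁ D₂ : Set Plane}
    {ρ₁ ρ₂ : Plane → ℂ} {a₁ a₂ : Fin 2 → ℂ} (hD₁ : IsAdmissible Ω P₁ D₁ ρ₁)
    (hD₂ : IsAdmissible Ω P₂ D₂ ρ₂) (ha₁ : a₁ ≠ 0)
    (hid : ∀ ζ : Fin 2 → ℂ, ζ 0 ^ 2 + ζ 1 ^ 2 = -(k : ℂ) ^ 2 →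
      (∑ i, a₁ i * ζ i) * ∫ x in D₁, ρ₁ x * planeExp ζ x =
        (∑ i, a₂ i * ζ i) * ∫ x in D₂, ρ₂ x * planeExp ζ x) {p : Plane}
    (hp : p ∈ (convexHull ℝ (Set.range P₁ ∪ Set.range P₂)).extremePoints ℝ) :
    p ∈ convexHull ℝ (Set.range P₂) := by
  by_contra hp₂
  obtain ⟨i, rfl⟩ : p ∈ Set.range P₁ := (extremePoints_convexHull_subset hp).resolve_right
    fun h => hp₂ (subset_convexHull ℝ _ h)
  set p := P₁ i with hpdef
  obtain ⟨f, c, hc, hf⟩ := exists_exposing_functional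
    ((Set.finite_range P₁).union (Set.finite_range P₂)) hp
  have hf₁ : ∀ x ∈ convexHull ℝ (Set.range P₁), c * ‖x - p‖ ≤ f (x - p) := fun x hx =>
    hf x (convexHull_mono Set.subset_union_left hx)
  have hP₁ := hD₁.isPolygonInterior
  have hP₂ := hD₂.isPolygonInterior
  obtain ⟨A, r, hr, hA₁, hA₂, hDA⟩ := hP₁.exists_corner i hc hf₁
  obtain ⟨η, s, C, ρ', hη, hs, -, hH, hρρ', hρ'p⟩ := hD₁.vertices i
  have hcont : ContinuousOn ρ' (Metric.closedBall p η) := hH.continuousOn hs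
  obtain ⟨r₁, hr₁, hr₁M⟩ := Metric.eventually_nhds_iff_ball.1
    ((hcont.continuousAt (Metric.closedBall_mem_nhds p hη)).norm.eventually_le_const
      (lt_add_one ‖ρ' p‖))
  -- Within `R` the sector description, the continuous representative of `ρ₁` and its bound `‖ρ' p‖
  -- + 1` all hold.
  set R := min r (min η r₁) with hR
  have hR0 : 0 < R := lt_min hr (lt_min hη hr₁)
  have hRr : R ≤ r := min_le_left _ _
  have hRη : R ≤ η := (min_le_right _ _).trans (min_le_left _ _)
  have hRr₁ : R ≤ r₁ := (min_le_right _ _).trans (min_le_right _ _)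
  have hf0 : f ≠ 0 := fun h => by simp [h] at hA₁
  obtain ⟨ζ, ξ, hζk, hζ, hξ, hlim, haξ⟩ := exists_frequencies f hf0 k ha₁
  have hi₁ := hP₁.integrableOn hD₁.memLp
  have hi₂ := hP₂.integrableOn hD₂.memLp
  have hm₁ := hP₁.isOpen.measurableSet
  obtain ⟨κ, hκ, hnear⟩ := tendsto_sq_mul_integral_corner hR0
    (hcont.mono (Metric.ball_subset_closedBall.trans (Metric.closedBall_subset_closedBall hRη)))
    (fun x hx => hr₁M x (Metric.ball_subset_ball hRr₁ hx)) A hA₁ hA₂ hm₁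
    (fun q hq => hDA q (hq.trans_le hRr)) hζ hξ hlim
  have hfar := tendsto_sq_mul_integral_planeExp_zero
    (hm₁.diff (Metric.isOpen_ball (x := p) (ε := R)).measurableSet)
    (hi₁.mono_set Set.sdiff_subset) (mul_pos hc hR0)
    (fun x hx => by
      refine le_trans (mul_le_mul_of_nonneg_left ?_ hc.le) (hf₁ x (hP₁.subset_convexHull hx.1))
      have := hx.2
      rwa [Metric.mem_ball, not_lt, dist_eq_norm] at this) hζ
  obtain ⟨d, hd, hdP⟩ := Metric.isOpen_iff.1
    ((Set.finite_range P₂).isClosed_convexHull ℝ).isOpen_compl p hp₂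
  have hright := tendsto_sq_mul_integral_planeExp_zero hP₂.isOpen.measurableSet hi₂
    (mul_pos hc hd) (fun x hx => by
      have hx' := hP₂.subset_convexHull hx
      refine le_trans (mul_le_mul_of_nonneg_left ?_ hc.le)
        (hf x (convexHull_mono Set.subset_union_right hx'))
      by_contra! h
      exact hdP (by rwa [Metric.mem_ball, dist_eq_norm]) hx') hζ
  -- Only the part near `p` may use `ρ'` in place of `ρ₁`; the rest is the exponentially small
  -- `hfar`.
  have hsplit : (fun τ : ℝ => (τ : ℂ) ^ 2 *
        (∫ x in D₁ ∩ Metric.ball p R, ρ' x * planeExp (ζ τ) (x - p)) +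
      (τ : ℂ) ^ 2 * ∫ x in D₁ \ Metric.ball p R, ρ₁ x * planeExp (ζ τ) (x - p)) =ᶠ[atTop]
      fun τ : ℝ => (τ : ℂ) ^ 2 * ∫ x in D₁, ρ₁ x * planeExp (ζ τ) (x - p) := by
    filter_upwards [eventually_ge_atTop 0] with τ hτ
    have hint : IntegrableOn (fun x => ρ₁ x * planeExp (ζ τ) (x - p)) D₁ := by
      refine Integrable.mul_bdd (c := 1) hi₁ ?_ (ae_restrict_of_forall_mem hm₁ fun x hx => ?_)
      · exact ((contDiff_planeExp _).continuous.comp (by fun_prop)).aestronglyMeasurable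
      · rw [norm_planeExp, hζ, Real.exp_le_one_iff, neg_nonpos]
        exact mul_nonneg hτ ((by positivity : 0 ≤ c * ‖x - p‖).trans
          (hf₁ x (hP₁.subset_convexHull hx)))
    rw [← integral_inter_add_sdiff (Metric.isOpen_ball (x := p) (ε := R)).measurableSet hint,
      mul_add]
    congr 2
    refine integral_congr_ae ?_
    have hsub : D₁ ∩ Metric.ball p R ⊆ Metric.ball p η ∩ D₁ := fun x hx =>
      ⟨Metric.ball_subset_ball hRη hx.2, hx.1⟩
    filter_upwards [ae_restrict_of_ae_restrict_of_subset hsub hρρ'] with x hx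
    rw [hx]
  have hdiv (a : Fin 2 → ℂ) : Tendsto (fun τ : ℝ => ∑ i, a i * (ζ τ i / τ)) atTop
      (𝓝 (∑ i, a i * ξ i)) := tendsto_finsetSum _ fun i _ => (hlim i).const_mul _
  have h₁ := (hdiv a₁).mul ((hnear.add hfar).congr' hsplit)
  have h₂ := (hdiv a₂).mul hright
  rw [mul_zero] at h₂
  -- Both sides of `hid`, stripped of `exp (ζ · p)` and multiplied by `τ² / τ`, have limits: the
  -- `D₁` side a nonzero one, the `D₂` side zero.
  have heq := tendsto_nhds_unique h₁ (h₂.congr fun τ => ?_)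
  · have hb (x : Plane) (hx : 0 < f x) : ∑ i, ξ i * x i ≠ 0 := fun h0 => by
      have := hξ x
      rw [h0, Complex.zero_re] at this
      linarith
    have hκ' : (κ : ℂ) ≠ 0 := by exact_mod_cast hκ
    rw [add_zero] at heq
    exact mul_ne_zero haξ (mul_ne_zero hκ' (mul_ne_zero hρ'p
      (one_div_ne_zero (mul_ne_zero (hb _ hA₁) (hb _ hA₂))))) heq
  · have hshift (D : Set Plane) (ρ : Plane → ℂ) : ∫ x in D, ρ x * planeExp (ζ τ) x =
        planeExp (ζ τ) p * ∫ x in D, ρ x * planeExp (ζ τ) (x - p) := by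
      rw [← integral_const_mul]
      refine integral_congr_ae (Eventually.of_forall fun x => ?_)
      have := planeExp_add (ζ τ) p (x - p)
      rw [add_sub_cancel] at this
      simp only [this]
      ring
    have h := hid (ζ τ) (hζk τ)
    rw [hshift, hshift, mul_left_comm, mul_left_comm _ (planeExp (ζ τ) p)] at h
    have h' := mul_left_cancel₀ (Complex.exp_ne_zero _) h
    have hs (a : Fin 2 → ℂ) : ∑ i, a i * (ζ τ i / τ) = (∑ i, a i * ζ τ i) / τ := by
      rw [Finset.sum_div]
      exact Finset.sum_congr rfl fun i _ => by ring
    rw [hs, hs]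
    linear_combination (-(τ : ℂ) ^ 2 / τ) * h'

theorem corollary2 (Ω : Opens Plane) (hΩ : IsLipschitzDomain Ω) (k : ℝ) (hk : 0 ≤ k)
    (n₁ n₂ : ℕ) [NeZero n₁] [NeZero n₂] (P₁ : Polygon Plane n₁) (P₂ : Polygon Plane n₂)
    (D₁ D₂ : Set Plane) (ρ₁ ρ₂ : Plane → ℂ) (a₁ a₂ : Fin 2 → ℂ)
    (hD₁ : IsAdmissible Ω P₁ D₁ ρ₁) (hD₂ : IsAdmissible Ω P₂ D₂ ρ₂)
    (ha₁ : a₁ ≠ 0) (ha₂ : a₂ ≠ 0)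
    (u₁ u₂ : SobolevH1 Ω)
    (hu₁ : IsWeakSolution k (dipoleSource D₁ ρ₁ a₁) u₁)
    (hu₂ : IsWeakSolution k (dipoleSource D₂ ρ₂ a₂) u₂)
    (c₁ c₂ : BoundaryL2 Ω × (TraceSpace Ω → ℂ))
    (hc₁ : HasCauchyData k (dipoleSource D₁ ρ₁ a₁) u₁ c₁)
    (hc₂ : HasCauchyData k (dipoleSource D₂ ρ₂ a₂) u₂ c₂)
    (hc : c₁ = c₂) :
    convexHull ℝ D₁ = convexHull ℝ D₂ := by
  subst hc
  have hP₁ := hD₁.isPolygonInterior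
  have hP₂ := hD₂.isPolygonInterior
  have hid (ζ : Fin 2 → ℂ) (hζ : ζ 0 ^ 2 + ζ 1 ^ 2 = -(k : ℂ) ^ 2) :=
    integral_mul_planeExp_eq_of_cauchyData_eq hΩ hP₁.isOpen hP₂.isOpen hD₁.closure_subset
      hD₂.closure_subset hc₁ hc₂ hζ
  set K := convexHull ℝ (Set.range P₁ ∪ Set.range P₂) with hK
  have hKc : IsCompact K :=
    ((Set.finite_range P₁).union (Set.finite_range P₂)).isCompact_convexHull ℝ
  -- Krein–Milman: it is enough to place the extreme points of `K` in each of the two vertex hulls.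
  have hKM := closure_convexHull_extremePoints hKc (convex_convexHull ℝ _)
  have h₂ : K ⊆ convexHull ℝ (Set.range P₂) := by
    rw [← hKM]
    exact closure_minimal (convexHull_min (fun p hp => mem_convexHull_of_mem_extremePoints
      hD₁ hD₂ ha₁ hid hp) (convex_convexHull ℝ _)) ((Set.finite_range P₂).isClosed_convexHull ℝ)
  have h₁ : K ⊆ convexHull ℝ (Set.range P₁) := by
    rw [← hKM]
    refine closure_minimal (convexHull_min (fun p hp => ?_) (convex_convexHull ℝ _))
      ((Set.finite_range P₁).isClosed_convexHull ℝ)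
    rw [hK, Set.union_comm] at hp
    exact mem_convexHull_of_mem_extremePoints hD₂ hD₁ ha₂ (fun ζ hζ => (hid ζ hζ).symm) hp
  rw [hP₁.convexHull_eq, hP₂.convexHull_eq,
    (h₁.antisymm (convexHull_mono Set.subset_union_left)).symm,
    (h₂.antisymm (convexHull_mono Set.subset_union_right)).symm]
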